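/- Let $\mathfrak g$ be a complex Lie algebra with a nondegenerate symmetric bilinear form $(\,,)$ that is invariant, $([x,y],z)+(y,[x,z])=0$. Let $\mathbb P$ be the complex projective line. For a set $S\subset\mathbb P$ let $\mathfrak g^S$ be the Lie algebra of meromorphic maps $\mathbb P\to\mathfrak g$ regular on $S$, and let $\mathcal V^S=U\mathfrak g^S\otimes_{U\mathfrak g}\mathbb C$, where $\mathfrak g\subset\mathfrak g^S$ is the algebra of constant maps; $\mathbf 1$ is the vacuum vector, $\mathcal V=\mathcal V^{\emptyset}$, and $K_z$ is the cotangent line of $\mathbb P$ at $z$. Let $u$ be a coordinate on $\mathbb P$, i.e. a meromorphic function with exactly one pole, which is simple. For $z$ not the pole of $u$, $v\in\mathfrak g$ and $S\not\ni z$ define linear maps $\mathcal V^{S\cup\{z\}}\to\mathcal V^{S}\otimes K_z$ as follows: $\epsilon^v(z)$ is left multiplication by $\frac{v}{u-u(z)}\otimes du_z$; $\iota^v(z)$ is determined by $\iota^v(z)\mathbf 1=0$ and, for $\alpha\in\mathfrak g^{S\cup\{z\}}$, $$\iota^{v}(z)\circ\alpha-\alpha\circ\iota^{v}(z)=-[\epsilon^{v}(z),\alpha]-(v,d\alpha(z))+\iota^{[v,\alpha(z)]}(z)+\epsilon^{[v,\alpha(z)]}(z);$$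 and the current is $j^v(z)=\epsilon^v(z)+\iota^v(z)$. For distinct points $z_1,\dots,z_n$, none of them the pole of $u$, and $v_1,\dots,v_n\in\mathfrak g$, the currents can be composed through $\mathcal V^{\{z_1,\dots,z_n\}}\to\mathcal V^{\{z_1,\dots,z_{n-1}\}}\otimes K_{z_n}\to\cdots\to\mathcal V\otimes K_{z_1}\otimes\cdots\otimes K_{z_n}$, and the $n$-point function $\langle j^{v_1}(z_1)\cdots j^{v_n}(z_n)\rangle\in K_{z_1}\otimes\cdots\otimes K_{z_n}$ is the coefficient of $\mathbf 1$ in the projection of $j^{v_1}(z_1)\cdots j^{v_n}(z_n)\mathbf 1$ to the span of $\mathbf 1$ along the span of all $\alpha\cdot x$ with $\alpha$ a meromorphic map and $x\in\mathcal V$. Products such as $du_{z_1}du_{z_2}$ are commutative (polydifferentials). Then the $n$-point functions do not depend on the choice of the coordinate $u$ (among those with no pole at the points $z_i$), and for $n\ge 1$, writing $u_i=u(z_i)$, $$\langle j^{v_1}(z_1)\cdots j^{v_n}(z_n)\rangle=\sum_{l=2}^n\Big\{\frac{(v_1,v_l)\,du_{z_1}du_{z_l}}{(u_1-u_l)^2}\langle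 j^{v_2}(z_2)\cdots\widehat{j^{v_l}(z_l)}\cdots j^{v_n}(z_n)\rangle+\frac{du_{z_1}}{u_1-u_l}\langle j^{v_2}(z_2)\cdots j^{[v_1,v_l]}(z_l)\cdots j^{v_n}(z_n)\rangle\Big\},$$ where the hat denotes an omitted term. In particular, with $u_{ij}=u_i-u_j$, $$\langle j^{v_1}(z_1)j^{v_2}(z_2)\rangle=\frac{(v_1,v_2)}{u_{12}^2}\,du_{z_1}du_{z_2},\qquad \langle j^{v_1}(z_1)j^{v_2}(z_2)j^{v_3}(z_3)\rangle=\frac{(v_1,[v_2,v_3])}{u_{12}u_{13}u_{23}}\,du_{z_1}du_{z_2}du_{z_3},$$ $$\begin{aligned}\langle j^{v_1}(z_1)j^{v_2}(z_2)j^{v_3}(z_3)j^{v_4}(z_4)\rangle=\Big\{&\frac{(v_1,v_2)(v_3,v_4)}{u_{12}^2u_{34}^2}+\frac{(v_1,v_3)(v_2,v_4)}{u_{13}^2u_{24}^2}+\frac{(v_1,v_4)(v_2,v_3)}{u_{14}^2u_{23}^2}+\frac{([v_1,v_2],[v_3,v_4])}{u_{12}u_{23}u_{24}u_{34}}\\&-\frac{([v_1,v_3],[v_2,v_4])}{u_{13}u_{23}u_{24}u_{34}}+\frac{([v_1,v_4],[v_2,v_3])}{u_{14}u_{34}u_{24}u_{23}}\Big\}\,du_{z_1}du_{z_2}du_{z_3}du_{z_4}.\end{aligned}$$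 -/

import Mathlib

open scoped TensorProduct DirectSum OnePoint

namespace CurrentAlgebra

noncomputable section

attribute [local instance 100] LieRing.ofAssociativeRing

/-! ### Meromorphic functions on the projective line -/

/-- The complex projective line `ℂ ∪ {∞}`. -/
abbrev ProjLine : Type := OnePoint ℂ

/-- The field of meromorphic (that is, rational) functions on the projective line, written in the
standard affine coordinate `X`. -/
abbrev MeroFun : Type := RatFunc ℂ

/-- The rational functions regular at the finite point `a`. -/
def localRingFin (a : ℂ) : Subalgebra ℂ MeroFun where
  carrier := {f | f.denom.eval a ≠ 0}
  mul_mem' {f g} hf hg h := by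
    have := Polynomial.eval_eq_zero_of_dvd_of_eval_eq_zero (RatFunc.denom_mul_dvd f g) h
    rw [Polynomial.eval_mul] at this
    exact (mul_ne_zero hf hg) this
  add_mem' {f g} hf hg h := by
    have := Polynomial.eval_eq_zero_of_dvd_of_eval_eq_zero (RatFunc.denom_add_dvd f g) h
    rw [Polynomial.eval_mul] at this
    exact (mul_ne_zero hf hg) this
  algebraMap_mem' c := by
    change (RatFunc.denom (algebraMap ℂ (RatFunc ℂ) c)).eval a ≠ 0
    rw [RatFunc.algebraMap_eq_C, RatFunc.denom_C]
    simp

/-- Evaluation at the finite point `a` of the rational functions regular there. -/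
def evalFin (a : ℂ) : localRingFin a →ₐ[ℂ] ℂ where
  toFun f := RatFunc.eval (RingHom.id ℂ) a f.1
  map_one' := RatFunc.eval_one _ _
  map_zero' := RatFunc.eval_zero _ _
  map_mul' f g := RatFunc.eval_mul _ _ f.2 g.2
  map_add' f g := RatFunc.eval_add _ _ f.2 g.2
  commutes' c := by
    change RatFunc.eval (RingHom.id ℂ) a (algebraMap ℂ (RatFunc ℂ) c) = c
    rw [RatFunc.algebraMap_eq_C, RatFunc.eval_C]
    rfl

/-- The substitution `f(X) ↦ f(1/X)`. -/
def invSubst : MeroFun →ₐ[ℂ] MeroFun :=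
  RatFunc.liftAlgHom (Polynomial.aeval (RatFunc.X⁻¹ : RatFunc ℂ)) (by
    apply nonZeroDivisors_le_comap_nonZeroDivisors_of_injective
    apply transcendental_iff_injective.mp
    refine RatFunc.transcendental_of_ne_C _ ?_
    rintro ⟨c, hc⟩
    have h : RatFunc.X = RatFunc.C c⁻¹ := by rw [map_inv₀, ← hc, inv_inv]
    have h2 := congrArg (RatFunc.eval (RingHom.id ℂ) (c⁻¹ + 1)) h
    rw [RatFunc.eval_X, RatFunc.eval_C] at h2
    simp at h2)

/-- The local ring of functions regular at a point of the projective line; regularity of `f(X)`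
at `∞` is regularity of `f(1/X)` at `0`. -/
def localRing : ProjLine → Subalgebra ℂ MeroFun
  | ∞ => (localRingFin 0).comap invSubst
  | (a : ℂ) => localRingFin a

/-- The value at a point of a function regular there. -/
def evalAt : (z : ProjLine) → (localRing z →ₐ[ℂ] ℂ)
  | ∞ => (evalFin 0).comp
      ((invSubst.comp (localRing ∞).val).codRestrict (localRingFin 0) fun f => f.2)
  | (a : ℂ) => evalFin a

/-- `f(z)`, with the conventional value `0` when `f` has a pole at `z`. -/
def value (z : ProjLine) (f : MeroFun) : ℂ :=
  open Classical in if h : f ∈ localRing z then evalAt z ⟨f, h⟩ else 0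

/-- The functions regular at all points of `S`; for `S = ∅` these are all meromorphic functions. -/
def regularOn (S : Set ProjLine) : Subalgebra ℂ MeroFun := ⨅ z ∈ S, localRing z

lemma regularOn_le {S : Set ProjLine} {z : ProjLine} (hz : z ∈ S) : regularOn S ≤ localRing z :=
  iInf₂_le z hz

lemma regularOn_anti {S T : Set ProjLine} (h : S ⊆ T) : regularOn T ≤ regularOn S :=
  biInf_mono h

/-- A function regarded as an element of `regularOn S` (with the conventional value `0` when it
has a pole in `S`). -/
def toRegular (S : Set ProjLine) (f : MeroFun) : regularOn S :=
  open Classical in if h : f ∈ regularOn S then ⟨f, h⟩ else 0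

/-- A coordinate on the projective line: a meromorphic function with exactly one pole `P`, and that
pole simple (`f * u` is regular at `P` whenever `f` is regular at `P` and vanishes there). -/
def IsCoordinate (u : MeroFun) : Prop :=
  ∃ P : ProjLine, u ∉ localRing P ∧
    (∀ f ∈ localRing P, value P f = 0 → f * u ∈ localRing P) ∧
    ∀ z : ProjLine, z ≠ P → u ∈ localRing z

/-! ### The canonical bundle -/

/-- The maximal ideal of the local ring at `z`. -/
abbrev maxIdeal (z : ProjLine) : Ideal (localRing z) := RingHom.ker (evalAt z)

/-- The fibre `K_z` at `z` of the canonical bundle, as the cotangent space `𝔪_z / 𝔪_z ^ 2`. -/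
def CanFiber (z : ProjLine) : Type := (maxIdeal z).Cotangent

instance (z : ProjLine) : AddCommGroup (CanFiber z) :=
  inferInstanceAs (AddCommGroup (maxIdeal z).Cotangent)

instance (z : ProjLine) : Module ℂ (CanFiber z) :=
  inferInstanceAs (Module ℂ (maxIdeal z).Cotangent)

lemma sub_eval_mem {A : Type*} [CommRing A] [Algebra ℂ A] (φ : A →ₐ[ℂ] ℂ) (f : A) :
    f - algebraMap ℂ A (φ f) ∈ RingHom.ker φ := by
  rw [RingHom.mem_ker, map_sub, AlgHom.commutes]
  exact sub_self _

/-- For a `ℂ`-point `φ` of a commutative algebra, with kernel `𝔪`, the differential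
`f ↦ df = f - φ(f)` modulo `𝔪 ^ 2`. -/
def cotDiff {A : Type*} [CommRing A] [Algebra ℂ A] (φ : A →ₐ[ℂ] ℂ) :
    A →ₗ[ℂ] (RingHom.ker φ).Cotangent where
  toFun f := (RingHom.ker φ).toCotangent ⟨_, sub_eval_mem φ f⟩
  map_add' f g := by
    rw [← map_add]
    congr 1
    ext
    simp
    ring
  map_smul' c f := by
    rw [RingHom.id_apply, ← algebraMap_smul A c ((RingHom.ker φ).toCotangent _), ← map_smul]
    congr 1
    ext
    simp [Algebra.smul_def]
    ring

lemma cotDiff_mul {A : Type*} [CommRing A] [Algebra ℂ A] (φ : A →ₐ[ℂ] ℂ) (f g : A) :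
    cotDiff φ (f * g) = φ f • cotDiff φ g + φ g • cotDiff φ f := by
  rw [← algebraMap_smul A (φ f), ← algebraMap_smul A (φ g)]
  simp only [cotDiff, LinearMap.coe_mk, AddHom.coe_mk]
  rw [← map_smul, ← map_smul, ← map_add, Ideal.toCotangent_eq, pow_two]
  have h := Ideal.mul_mem_mul (sub_eval_mem φ f) (sub_eval_mem φ g)
  convert h using 1
  simp only [Submodule.coe_add, Submodule.coe_smul, smul_eq_mul, map_mul]
  ring

/-- The differential `f ↦ df_z`, the class of `f - f(z)` modulo `𝔪_z ^ 2`. -/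
def dAt (z : ProjLine) : localRing z →ₗ[ℂ] CanFiber z := cotDiff (evalAt z)

/-- The Leibniz rule `d(fg)_z = f(z) dg_z + g(z) df_z`. -/
lemma dAt_mul (z : ProjLine) (f g : localRing z) :
    dAt z (f * g) = evalAt z f • dAt z g + evalAt z g • dAt z f :=
  cotDiff_mul _ f g

/-- `df_z`, with the conventional value `0` when `f` has a pole at `z`. -/
def diff (z : ProjLine) (f : MeroFun) : CanFiber z :=
  open Classical in if h : f ∈ localRing z then dAt z ⟨f, h⟩ else 0

/-! ### Meromorphic maps into a Lie algebra and the vacuum module -/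

section

variable {𝔤 : Type*} [LieRing 𝔤] [LieAlgebra ℂ 𝔤]

variable (𝔤) in
/-- The Lie algebra of meromorphic maps from the projective line to `𝔤` regular on `S`. -/
def MeroMaps (S : Set ProjLine) : Type _ := regularOn S ⊗[ℂ] 𝔤

instance (S : Set ProjLine) : LieRing (MeroMaps 𝔤 S) :=
  inferInstanceAs (LieRing (regularOn S ⊗[ℂ] 𝔤))

instance (S : Set ProjLine) : LieAlgebra ℂ (MeroMaps 𝔤 S) :=
  inferInstanceAs (LieAlgebra ℂ (regularOn S ⊗[ℂ] 𝔤))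

/-- The map `f ⊗ x`, that is, `z ↦ f(z) x`. -/
def mapOf {S : Set ProjLine} (f : regularOn S) : 𝔤 →ₗ[ℂ] MeroMaps 𝔤 S :=
  TensorProduct.mk ℂ (regularOn S) 𝔤 f

lemma mapOf_lie {S : Set ProjLine} (f g : regularOn S) (x y : 𝔤) :
    ⁅mapOf f x, mapOf g y⁆ = mapOf (f * g) ⁅x, y⁆ := rfl

lemma meroMaps_induction {S : Set ProjLine} {p : MeroMaps 𝔤 S → Prop} (α : MeroMaps 𝔤 S)
    (zero : p 0) (tmul : ∀ f x, p (mapOf f x)) (add : ∀ α β, p α → p β → p (α + β)) : p α :=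
  TensorProduct.induction_on (motive := p) α zero tmul add

/-- The inclusion of Lie algebras of maps, for `S ⊆ T`. -/
def inclMaps {S T : Set ProjLine} (h : S ⊆ T) : MeroMaps 𝔤 T →ₗ⁅ℂ⁆ MeroMaps 𝔤 S :=
  LieAlgebra.ExtendScalars.map (Subalgebra.inclusion (regularOn_anti h)) LieHom.id

/-- The value `α(z)` of a map regular at `z`. -/
def mapValue {S : Set ProjLine} {z : ProjLine} (hz : z ∈ S) : MeroMaps 𝔤 S →ₗ[ℂ] 𝔤 :=
  TensorProduct.lift (LinearMap.lsmul ℂ 𝔤 ∘ₗ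
    ((evalAt z).comp (Subalgebra.inclusion (regularOn_le hz))).toLinearMap)

/-- The element `(v, dα(z))` of `K_z`, for a map `α` regular at `z`. -/
def pairDiff (B : LinearMap.BilinForm ℂ 𝔤) {S : Set ProjLine} {z : ProjLine} (hz : z ∈ S) :
    𝔤 →ₗ[ℂ] MeroMaps 𝔤 S →ₗ[ℂ] CanFiber z where
  toFun v := TensorProduct.lift (((LinearMap.lsmul ℂ (CanFiber z)).flip ∘ₗ dAt z ∘ₗ
    (Subalgebra.inclusion (regularOn_le hz)).toLinearMap).compl₂ (B v))
  map_add' v w := TensorProduct.ext (by ext; simp [add_smul]; rfl)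
  map_smul' c v := TensorProduct.ext (by ext; simp [mul_smul]; rfl)

lemma pairDiff_mapOf (B : LinearMap.BilinForm ℂ 𝔤) {S : Set ProjLine} {z : ProjLine} (hz : z ∈ S)
    (v : 𝔤) (f : regularOn S) (x : 𝔤) :
    pairDiff B hz v (mapOf f x) = B v x • dAt z (Subalgebra.inclusion (regularOn_le hz) f) := rfl

variable (𝔤) in
/-- The universal enveloping algebra of the Lie algebra of maps regular on `S`. -/
abbrev Env (S : Set ProjLine) : Type _ := UniversalEnvelopingAlgebra ℂ (MeroMaps 𝔤 S)

variable (𝔤) in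
/-- The left ideal generated by the constant maps. -/
def constIdeal (S : Set ProjLine) : Ideal (Env 𝔤 S) :=
  Ideal.span (Set.range fun x : 𝔤 => UniversalEnvelopingAlgebra.ι ℂ (mapOf (1 : regularOn S) x))

variable (𝔤) in
/-- The space `𝒱^S = U(𝔤 ⊗ 𝒪_S) ⊗_{U𝔤} ℂ`, the quotient of the enveloping algebra by the left ideal
generated by the constant maps. For `S = ∅` this is the full vacuum module `𝒱`. -/
def VacModule (S : Set ProjLine) : Type _ := Env 𝔤 S ⧸ constIdeal 𝔤 S

instance (S : Set ProjLine) : AddCommGroup (VacModule 𝔤 S) :=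
  inferInstanceAs (AddCommGroup (Env 𝔤 S ⧸ constIdeal 𝔤 S))

instance (S : Set ProjLine) : Module (Env 𝔤 S) (VacModule 𝔤 S) :=
  inferInstanceAs (Module (Env 𝔤 S) (Env 𝔤 S ⧸ constIdeal 𝔤 S))

instance (S : Set ProjLine) : Module ℂ (VacModule 𝔤 S) :=
  inferInstanceAs (Module ℂ (Env 𝔤 S ⧸ constIdeal 𝔤 S))

instance (S : Set ProjLine) : IsScalarTower ℂ (Env 𝔤 S) (VacModule 𝔤 S) :=
  inferInstanceAs (IsScalarTower ℂ (Env 𝔤 S) (Env 𝔤 S ⧸ constIdeal 𝔤 S))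

variable (𝔤) in
/-- The class `a · 1` of an element of the enveloping algebra. -/
def vacMk (S : Set ProjLine) : Env 𝔤 S →ₗ[Env 𝔤 S] VacModule 𝔤 S := (constIdeal 𝔤 S).mkQ

variable (𝔤) in
/-- The vacuum vector. -/
def vacuum (S : Set ProjLine) : VacModule 𝔤 S := vacMk 𝔤 S 1

/-- The action of meromorphic maps on the vacuum module by left multiplication. -/
def act (S : Set ProjLine) : MeroMaps 𝔤 S →ₗ⁅ℂ⁆ Module.End ℂ (VacModule 𝔤 S) :=
  (AlgHom.toLieHom (Algebra.lsmul ℂ ℂ (VacModule 𝔤 S) :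
    Env 𝔤 S →ₐ[ℂ] Module.End ℂ (VacModule 𝔤 S))).comp
    (UniversalEnvelopingAlgebra.ι ℂ)

lemma act_const (S : Set ProjLine) (x : 𝔤) : act S (mapOf 1 x) (vacuum 𝔤 S) = 0 := by
  change UniversalEnvelopingAlgebra.ι ℂ (mapOf (1 : regularOn S) x) • vacMk 𝔤 S 1 = 0
  rw [← map_smul, smul_eq_mul, mul_one]
  refine (Submodule.Quotient.mk_eq_zero _).mpr ?_
  exact Ideal.subset_span ⟨x, rfl⟩

/-- The universal property of the vacuum module: the linear map
`α₁ ⋯ α_k · 1 ↦ ρ(α₁) ⋯ ρ(α_k) m`, where `ρ` is a representation and the constants kill `m`. -/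
def induced {S : Set ProjLine} {M : Type*} [AddCommGroup M] [Module ℂ M]
    (ρ : MeroMaps 𝔤 S →ₗ⁅ℂ⁆ Module.End ℂ M) (m : M)
    (hm : ∀ x : 𝔤, ρ (mapOf 1 x) m = 0) : VacModule 𝔤 S →ₗ[ℂ] M :=
  ((constIdeal 𝔤 S).restrictScalars ℂ).liftQ
      (LinearMap.applyₗ m ∘ₗ (UniversalEnvelopingAlgebra.lift ℂ ρ).toLinearMap) (by
    intro a ha
    have ha' : a ∈ constIdeal 𝔤 S := ha
    clear ha
    change UniversalEnvelopingAlgebra.lift ℂ ρ a m = 0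
    refine Submodule.span_induction ?_ ?_ ?_ ?_ ha'
    · rintro _ ⟨x, rfl⟩
      rw [UniversalEnvelopingAlgebra.lift_ι_apply]
      exact hm x
    · simp
    · intro a b _ _ h1 h2
      rw [map_add, LinearMap.add_apply, h1, h2, add_zero]
    · intro a b _ h
      rw [smul_eq_mul, map_mul, Module.End.mul_apply, h, map_zero]) ∘ₗ
    (Submodule.Quotient.restrictScalarsEquiv ℂ (constIdeal 𝔤 S)).symm.toLinearMap

lemma induced_vacuum {S : Set ProjLine} {M : Type*} [AddCommGroup M] [Module ℂ M]
    (ρ : MeroMaps 𝔤 S →ₗ⁅ℂ⁆ Module.End ℂ M) (m : M)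
    (hm : ∀ x : 𝔤, ρ (mapOf 1 x) m = 0) :
    induced ρ m hm (vacuum 𝔤 S) = m := by
  change UniversalEnvelopingAlgebra.lift ℂ ρ 1 m = m
  rw [map_one, Module.End.one_apply]

lemma induced_act {S : Set ProjLine} {M : Type*} [AddCommGroup M] [Module ℂ M]
    (ρ : MeroMaps 𝔤 S →ₗ⁅ℂ⁆ Module.End ℂ M) (m : M)
    (hm : ∀ x : 𝔤, ρ (mapOf 1 x) m = 0) (α : MeroMaps 𝔤 S) (x : VacModule 𝔤 S) :
    induced ρ m hm (act S α x) = ρ α (induced ρ m hm x) := by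
  obtain ⟨a, rfl⟩ := Submodule.mkQ_surjective _ x
  change UniversalEnvelopingAlgebra.lift ℂ ρ (UniversalEnvelopingAlgebra.ι ℂ α * a) m =
    ρ α (UniversalEnvelopingAlgebra.lift ℂ ρ a m)
  rw [map_mul, UniversalEnvelopingAlgebra.lift_ι_apply, Module.End.mul_apply]

/-- The natural map `𝒱^T → 𝒱^S`, for `S ⊆ T`. -/
def inclVac {S T : Set ProjLine} (h : S ⊆ T) : VacModule 𝔤 T →ₗ[ℂ] VacModule 𝔤 S :=
  induced ((act S).comp (inclMaps h)) (vacuum 𝔤 S) fun x => act_const S x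

lemma inclVac_vacuum {S T : Set ProjLine} (h : S ⊆ T) :
    inclVac h (vacuum 𝔤 T) = vacuum 𝔤 S :=
  induced_vacuum ((act S).comp (inclMaps h)) (vacuum 𝔤 S) fun x => act_const S x

lemma inclVac_act {S T : Set ProjLine} (h : S ⊆ T) (α : MeroMaps 𝔤 T) (x : VacModule 𝔤 T) :
    inclVac h (act T α x) = act S (inclMaps h α) (inclVac h x) :=
  induced_act ((act S).comp (inclMaps h)) (vacuum 𝔤 S) (fun x => act_const S x) α x

/-- The projection of the vacuum module onto the line spanned by the vacuum vector, along the
span of all `α · x` with `α` a meromorphic map, as a linear form. -/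
def vacProj (S : Set ProjLine) : VacModule 𝔤 S →ₗ[ℂ] ℂ :=
  induced 0 1 fun _ => rfl

lemma mapValue_mapOf {S : Set ProjLine} {z : ProjLine} (hz : z ∈ S) (f : regularOn S) (x : 𝔤) :
    mapValue hz (mapOf f x) = evalAt z (Subalgebra.inclusion (regularOn_le hz) f) • x := rfl

lemma mapValue_lie {S : Set ProjLine} {z : ProjLine} (hz : z ∈ S) (α β : MeroMaps 𝔤 S) :
    mapValue hz ⁅α, β⁆ = ⁅mapValue hz α, mapValue hz β⁆ := by
  induction α using meroMaps_induction with
  | zero => simp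
  | add α₁ α₂ h₁ h₂ => simp only [add_lie, map_add, h₁, h₂]
  | tmul f x =>
    induction β using meroMaps_induction with
    | zero => simp
    | add β₁ β₂ h₁ h₂ => simp only [lie_add, map_add, h₁, h₂]
    | tmul g y =>
      rw [mapOf_lie, mapValue_mapOf, mapValue_mapOf, mapValue_mapOf]
      simp only [smul_lie, lie_smul, map_mul, mul_smul]
      exact smul_comm _ _ _

variable (𝔤) in
/-- The evaluation at `z` as a homomorphism of Lie algebras. -/
def mapValueHom {S : Set ProjLine} {z : ProjLine} (hz : z ∈ S) : MeroMaps 𝔤 S →ₗ⁅ℂ⁆ 𝔤 :=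
  { mapValue hz with map_lie' := mapValue_lie hz _ _ }

lemma pairDiff_lie (B : LinearMap.BilinForm ℂ 𝔤) (hB : B.lieInvariant 𝔤) {S : Set ProjLine}
    {z : ProjLine} (hz : z ∈ S) (v : 𝔤) (α β : MeroMaps 𝔤 S) :
    pairDiff B hz v ⁅α, β⁆ = pairDiff B hz ⁅v, mapValueHom 𝔤 hz α⁆ β
      - pairDiff B hz ⁅v, mapValueHom 𝔤 hz β⁆ α := by
  have hval : ∀ γ : MeroMaps 𝔤 S, mapValueHom 𝔤 hz γ = mapValue hz γ := fun _ => rfl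
  simp only [hval]
  induction α using meroMaps_induction with
  | zero => simp
  | add α₁ α₂ h₁ h₂ =>
    simp only [add_lie, lie_add, map_add, LinearMap.add_apply, h₁, h₂]
    abel
  | tmul f x =>
    induction β using meroMaps_induction with
    | zero => simp
    | add β₁ β₂ h₁ h₂ =>
      simp only [lie_add, map_add, LinearMap.add_apply, h₁, h₂]
      abel
    | tmul g y =>
      have e1 : B ⁅v, x⁆ y = B v ⁅x, y⁆ := by
        rw [← lie_skew v x, map_neg, LinearMap.neg_apply, hB, neg_neg]
      have e2 : B ⁅v, y⁆ x = - B v ⁅x, y⁆ := by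
        rw [← lie_skew v y, map_neg, LinearMap.neg_apply, hB, neg_neg, ← lie_skew x y, map_neg, neg_neg]
      rw [mapOf_lie]
      simp only [mapValue_mapOf, lie_smul, map_smul, LinearMap.smul_apply, pairDiff_mapOf, e1, e2, map_mul, dAt_mul, smul_add, neg_smul, smul_neg, sub_neg_eq_add]
      rw [smul_comm (B v ⁅x, y⁆), smul_comm (B v ⁅x, y⁆)]

/-! ### The fields -/

/-- The recursion that defines `ι`, as a representation of a Lie algebra `L` of maps on pairs
`q = (ι^(·) β, β)`. Here `a` is the action of `L` by left multiplication, `c` is evaluation at `z`,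
`E` is the field `ε`, and `p v α` is `(v, dα(z))`; an element `α` sends `ι^v β` to
`ι^v (α β) = α ι^v β - [ε^v, α] β - (v, dα(z)) β + ι^[v, α(z)] β + ε^[v, α(z)] β`. -/
def iotaAction {L N K 𝔤 : Type*} [LieRing L] [LieAlgebra ℂ L] [LieRing 𝔤] [LieAlgebra ℂ 𝔤]
    [AddCommGroup N] [Module ℂ N] [AddCommGroup K] [Module ℂ K]
    (a : L →ₗ⁅ℂ⁆ Module.End ℂ N) (c : L →ₗ⁅ℂ⁆ 𝔤) (E : 𝔤 →ₗ[ℂ] N →ₗ[ℂ] N ⊗[ℂ] K)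
    (p : 𝔤 →ₗ[ℂ] L →ₗ[ℂ] K) (hp : ∀ v α β, p v ⁅α, β⁆ = p ⁅v, c α⁆ β - p ⁅v, c β⁆ α) :
    L →ₗ⁅ℂ⁆ Module.End ℂ ((𝔤 →ₗ[ℂ] N ⊗[ℂ] K) × N) where
  toFun α :=
    { toFun := fun q =>
        ({  toFun := fun v => (a α).rTensor K (q.1 v) - (E v (a α q.2) - (a α).rTensor K (E v q.2))
                - q.2 ⊗ₜ p v α + q.1 ⁅v, c α⁆ + E ⁅v, c α⁆ q.2
            map_add' := fun v w => by
              simp only [map_add, add_lie, LinearMap.add_apply, TensorProduct.tmul_add]; abel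
            map_smul' := fun r v => by
              simp only [map_smul, smul_lie, LinearMap.smul_apply, TensorProduct.tmul_smul,
                RingHom.id_apply, smul_add, smul_sub] },
          a α q.2)
      map_add' := fun q r => by
        refine Prod.ext (LinearMap.ext fun v => ?_) (by simp)
        simp only [Prod.fst_add, Prod.snd_add, map_add, LinearMap.add_apply, TensorProduct.add_tmul,
          LinearMap.coe_mk, AddHom.coe_mk, Prod.mk_add_mk]
        abel
      map_smul' := fun r q => by
        refine Prod.ext (LinearMap.ext fun v => ?_) (by simp)
        simp only [Prod.smul_fst, Prod.smul_snd, map_smul, LinearMap.smul_apply,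
          ← TensorProduct.smul_tmul', LinearMap.coe_mk, AddHom.coe_mk, RingHom.id_apply,
          smul_add, smul_sub, Prod.smul_mk] }
  map_add' α β := by
    refine LinearMap.ext fun q => Prod.ext (LinearMap.ext fun v => ?_) (by simp)
    simp only [map_add, lie_add, LinearMap.add_apply, LinearMap.rTensor_add,
      TensorProduct.tmul_add, LinearMap.coe_mk, AddHom.coe_mk, Prod.mk_add_mk]
    abel
  map_smul' r α := by
    refine LinearMap.ext fun q => Prod.ext (LinearMap.ext fun v => ?_) (by simp)
    simp only [map_smul, lie_smul, LinearMap.smul_apply, LinearMap.rTensor_smul,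
      TensorProduct.tmul_smul, LinearMap.coe_mk, AddHom.coe_mk, RingHom.id_apply, Prod.smul_mk,
      smul_add, smul_sub]
  map_lie' {α β} := by
    have h1 : ∀ x : N, a ⁅α, β⁆ x = a α (a β x) - a β (a α x) := fun x => by
      rw [LieHom.map_lie]; rfl
    have h2 : ∀ x : N ⊗[ℂ] K, (a ⁅α, β⁆).rTensor K x = (a α).rTensor K ((a β).rTensor K x)
        - (a β).rTensor K ((a α).rTensor K x) := fun x => by
      rw [LieHom.map_lie, LieRing.of_associative_ring_bracket, LinearMap.rTensor_sub,
        LinearMap.rTensor_mul, LinearMap.rTensor_mul]; rfl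
    have h3 : ∀ v : 𝔤, ⁅v, c ⁅α, β⁆⁆ = ⁅⁅v, c α⁆, c β⁆ - ⁅⁅v, c β⁆, c α⁆ := fun v => by
      rw [LieHom.map_lie, leibniz_lie, ← lie_skew ⁅v, c β⁆ (c α)]; abel
    refine LinearMap.ext fun q => Prod.ext (LinearMap.ext fun v => ?_) (h1 q.2)
    simp only [LieRing.of_associative_ring_bracket, Module.End.mul_apply, LinearMap.sub_apply,
      LinearMap.coe_mk, AddHom.coe_mk, Prod.fst_sub, h1, h2, h3, hp, map_sub, map_add,
      TensorProduct.tmul_sub, LinearMap.rTensor_tmul]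
    abel

variable (𝔤) in
/-- The map `v / (u - u(z))`, regular on `S` if `z ∉ S`. -/
def epsMap (u : MeroFun) (z : ProjLine) (S : Set ProjLine) (v : 𝔤) : MeroMaps 𝔤 S :=
  mapOf (toRegular S (u - RatFunc.C (value z u))⁻¹) v

variable (𝔤) in
/-- The field `ε^v(z)`: left multiplication by `v / (u - u(z)) ⊗ du_z`. -/
def eps (u : MeroFun) (z : ProjLine) (S : Set ProjLine) :
    𝔤 →ₗ[ℂ] VacModule 𝔤 S →ₗ[ℂ] VacModule 𝔤 S ⊗[ℂ] CanFiber z where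
  toFun v := (TensorProduct.mk ℂ _ _).flip (diff z u) ∘ₗ act S (epsMap 𝔤 u z S v)
  map_add' v w := by
    refine LinearMap.ext fun x => ?_
    simp only [epsMap, map_add, LinearMap.comp_apply, LinearMap.add_apply]
  map_smul' c v := by
    refine LinearMap.ext fun x => ?_
    simp only [epsMap, map_smul, LinearMap.comp_apply, LinearMap.smul_apply, RingHom.id_apply]

lemma eps_apply (u : MeroFun) (z : ProjLine) (S : Set ProjLine) (v : 𝔤) (x : VacModule 𝔤 S) :
    eps 𝔤 u z S v x = act S (epsMap 𝔤 u z S v) x ⊗ₜ diff z u := rfl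

/-- The representation of the maps regular at `z` and on `S` that defines `ι(z)`. -/
def iotaRep (B : LinearMap.BilinForm ℂ 𝔤) (hB : B.lieInvariant 𝔤) (u : MeroFun) (z : ProjLine)
    (S : Set ProjLine) : MeroMaps 𝔤 (insert z S) →ₗ⁅ℂ⁆ Module.End ℂ
      ((𝔤 →ₗ[ℂ] VacModule 𝔤 S ⊗[ℂ] CanFiber z) × VacModule 𝔤 S) :=
  iotaAction ((act S).comp (inclMaps (Set.subset_insert z S)))
    (mapValueHom 𝔤 (Set.mem_insert z S)) (eps 𝔤 u z S) (pairDiff B (Set.mem_insert z S))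
    (pairDiff_lie B hB (Set.mem_insert z S))

lemma iotaRep_snd (B : LinearMap.BilinForm ℂ 𝔤) (hB : B.lieInvariant 𝔤) (u : MeroFun)
    (z : ProjLine) (S : Set ProjLine) (α : MeroMaps 𝔤 (insert z S))
    (q : (𝔤 →ₗ[ℂ] VacModule 𝔤 S ⊗[ℂ] CanFiber z) × VacModule 𝔤 S) :
    (iotaRep B hB u z S α q).2 = act S (inclMaps (Set.subset_insert z S) α) q.2 := rfl

lemma iotaRep_fst (B : LinearMap.BilinForm ℂ 𝔤) (hB : B.lieInvariant 𝔤) (u : MeroFun)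
    (z : ProjLine) (S : Set ProjLine) (α : MeroMaps 𝔤 (insert z S))
    (q : (𝔤 →ₗ[ℂ] VacModule 𝔤 S ⊗[ℂ] CanFiber z) × VacModule 𝔤 S) (v : 𝔤) :
    (iotaRep B hB u z S α q).1 v =
      (act S (inclMaps (Set.subset_insert z S) α)).rTensor (CanFiber z) (q.1 v)
        - (eps 𝔤 u z S v (act S (inclMaps (Set.subset_insert z S) α) q.2)
          - (act S (inclMaps (Set.subset_insert z S) α)).rTensor (CanFiber z) (eps 𝔤 u z S v q.2))
        - q.2 ⊗ₜ pairDiff B (Set.mem_insert z S) v α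
        + q.1 ⁅v, mapValue (Set.mem_insert z S) α⁆
        + eps 𝔤 u z S ⁅v, mapValue (Set.mem_insert z S) α⁆ q.2 := rfl

lemma dAt_one (z : ProjLine) : dAt z 1 = 0 := by
  have h := dAt_mul z 1 1
  rwa [mul_one, map_one (evalAt z), one_smul, left_eq_add] at h

lemma iotaRep_const (B : LinearMap.BilinForm ℂ 𝔤) (hB : B.lieInvariant 𝔤) (u : MeroFun)
    (z : ProjLine) (S : Set ProjLine) (x : 𝔤) :
    iotaRep B hB u z S (mapOf 1 x) (0, vacuum 𝔤 S) = 0 := by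
  have h1 : inclMaps (Set.subset_insert z S) (mapOf 1 x) = mapOf (1 : regularOn S) x := rfl
  refine Prod.ext (LinearMap.ext fun v => ?_) ?_
  · rw [iotaRep_fst, h1, pairDiff_mapOf, mapValue_mapOf,
      map_one (Subalgebra.inclusion _), map_one (evalAt z), one_smul, dAt_one]
    simp only [act_const, map_zero, LinearMap.zero_apply, zero_sub, sub_neg_eq_add, zero_add,
      smul_zero, TensorProduct.tmul_zero, sub_zero, add_zero, Prod.fst_zero]
    rw [eps_apply, eps_apply, LinearMap.rTensor_tmul, ← TensorProduct.add_tmul]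
    have h2 : act S (mapOf 1 x) (act S (epsMap 𝔤 u z S v) (vacuum 𝔤 S))
        = act S ⁅mapOf (1 : regularOn S) x, epsMap 𝔤 u z S v⁆ (vacuum 𝔤 S) := by
      rw [LieHom.map_lie, LieRing.of_associative_ring_bracket, LinearMap.sub_apply,
        Module.End.mul_apply, Module.End.mul_apply, act_const, map_zero, sub_zero]
    rw [h2, epsMap, epsMap, mapOf_lie, one_mul, ← lie_skew, map_neg, map_neg, LinearMap.neg_apply,
      neg_add_cancel, TensorProduct.zero_tmul]
  · rw [iotaRep_snd, h1]
    exact act_const S x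

/-- The field `ι^v(z) : 𝒱^{z} → 𝒱 ⊗ K_z`, restricted to `𝒱^{S ∪ {z}}` and with values in
`𝒱^S ⊗ K_z`. It kills the vacuum and satisfies the recursion of `iotaAction`. -/
def iota (B : LinearMap.BilinForm ℂ 𝔤) (hB : B.lieInvariant 𝔤) (u : MeroFun) (z : ProjLine)
    (S : Set ProjLine) (v : 𝔤) :
    VacModule 𝔤 (insert z S) →ₗ[ℂ] VacModule 𝔤 S ⊗[ℂ] CanFiber z :=
  LinearMap.applyₗ v ∘ₗ LinearMap.fst ℂ _ _ ∘ₗ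
    induced (iotaRep B hB u z S) (0, vacuum 𝔤 S) (iotaRep_const B hB u z S)

lemma vac_induction {S : Set ProjLine} {p : VacModule 𝔤 S → Prop} (x : VacModule 𝔤 S)
    (vac : p (vacuum 𝔤 S)) (smul : ∀ (c : ℂ) x, p x → p (c • x))
    (add : ∀ x y, p x → p y → p (x + y)) (act : ∀ α x, p x → p (act S α x)) : p x := by
  obtain ⟨a, rfl⟩ := Submodule.mkQ_surjective (constIdeal 𝔤 S) x
  obtain ⟨t, rfl⟩ : ∃ t, UniversalEnvelopingAlgebra.mkAlgHom ℂ (MeroMaps 𝔤 S) t = a :=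
    RingCon.mkₐ_surjective _ a
  have key : ∀ x, p x → p (UniversalEnvelopingAlgebra.mkAlgHom ℂ (MeroMaps 𝔤 S) t • x) := by
    induction t using TensorAlgebra.induction with
    | algebraMap c =>
      intro x hx
      rw [AlgHom.commutes, algebraMap_smul]
      exact smul c x hx
    | ι α => exact fun x hx => act α x hx
    | mul a b ha hb =>
      intro x hx
      rw [map_mul, mul_smul]
      exact ha _ (hb _ hx)
    | add a b ha hb =>
      intro x hx
      rw [map_add, add_smul]
      exact add _ _ (ha _ hx) (hb _ hx)
  have h := key _ vac
  rwa [vacuum, ← map_smul, smul_eq_mul, mul_one] at h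

lemma iota_vacuum (B : LinearMap.BilinForm ℂ 𝔤) (hB : B.lieInvariant 𝔤) (u : MeroFun)
    (z : ProjLine) (S : Set ProjLine) (v : 𝔤) :
    iota B hB u z S v (vacuum 𝔤 (insert z S)) = 0 := by
  simp only [iota, LinearMap.comp_apply, induced_vacuum]
  rfl

/-- The recursion that defines `ι`. -/
lemma iota_act (B : LinearMap.BilinForm ℂ 𝔤) (hB : B.lieInvariant 𝔤) (u : MeroFun)
    (z : ProjLine) (S : Set ProjLine) (v : 𝔤) (α : MeroMaps 𝔤 (insert z S))
    (β : VacModule 𝔤 (insert z S)) :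
    let incl : VacModule 𝔤 (insert z S) →ₗ[ℂ] VacModule 𝔤 S := inclVac (Set.subset_insert z S)
    let αS : MeroMaps 𝔤 S := inclMaps (Set.subset_insert z S) α
    let vα : 𝔤 := ⁅v, mapValue (Set.mem_insert z S) α⁆
    iota B hB u z S v (act _ α β) = (act S αS).rTensor (CanFiber z) (iota B hB u z S v β)
      - (eps 𝔤 u z S v (act S αS (incl β))
        - (act S αS).rTensor (CanFiber z) (eps 𝔤 u z S v (incl β)))
      - incl β ⊗ₜ pairDiff B (Set.mem_insert z S) v α
      + iota B hB u z S vα β + eps 𝔤 u z S vα (incl β) := by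
  intro incl αS vα
  have hs : ∀ x, (induced (iotaRep B hB u z S) (0, vacuum 𝔤 S) (iotaRep_const B hB u z S) x).2
      = incl x := by
    intro x
    induction x using vac_induction with
    | vac => rw [induced_vacuum]; exact (inclVac_vacuum _).symm
    | smul c x h => rw [map_smul, map_smul, Prod.smul_snd, h]
    | add x y h₁ h₂ => rw [map_add, map_add, Prod.snd_add, h₁, h₂]
    | act γ x h => rw [induced_act, iotaRep_snd, h]; exact (inclVac_act _ _ _).symm
  change (induced (iotaRep B hB u z S) (0, vacuum 𝔤 S) (iotaRep_const B hB u z S) _).1 v = _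
  rw [induced_act, iotaRep_fst, hs]
  rfl

/-- The current `j^v(z) = ε^v(z) + ι^v(z)`. -/
def current (B : LinearMap.BilinForm ℂ 𝔤) (hB : B.lieInvariant 𝔤) (u : MeroFun) (z : ProjLine)
    (S : Set ProjLine) (v : 𝔤) :
    VacModule 𝔤 (insert z S) →ₗ[ℂ] VacModule 𝔤 S ⊗[ℂ] CanFiber z :=
  eps 𝔤 u z S v ∘ₗ inclVac (Set.subset_insert z S) + iota B hB u z S v

/-! ### Polydifferentials and `n`-point functions -/

/-- The symmetric algebra on all the lines `K_z`. For distinct `z₁, …, z_n` it contains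
`K_{z₁} ⊗ ⋯ ⊗ K_{z_n}` as the span of the products `ω₁ ⋯ ω_n` with `ω_i ∈ K_{z_i}`. -/
abbrev PolyDiff : Type := SymmetricAlgebra ℂ (⨁ z : ProjLine, CanFiber z)

/-- The inclusion of `K_z` in the algebra of polydifferentials. -/
def ofFiber (z : ProjLine) : CanFiber z →ₗ[ℂ] PolyDiff :=
  open Classical in SymmetricAlgebra.ι ℂ _ ∘ₗ DirectSum.lof ℂ ProjLine (fun z => CanFiber z) z

/-- The differential `du_z` as a polydifferential. -/
def du (u : MeroFun) (z : ProjLine) : PolyDiff := ofFiber z (diff z u)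

/-- The current, extended linearly to polydifferential coefficients. -/
def currentExt (B : LinearMap.BilinForm ℂ 𝔤) (hB : B.lieInvariant 𝔤) (u : MeroFun) (z : ProjLine)
    (S : Set ProjLine) (v : 𝔤) :
    VacModule 𝔤 (insert z S) ⊗[ℂ] PolyDiff →ₗ[ℂ] VacModule 𝔤 S ⊗[ℂ] PolyDiff :=
  (LinearMap.mul' ℂ PolyDiff ∘ₗ (ofFiber z).rTensor PolyDiff).lTensor (VacModule 𝔤 S) ∘ₗ
    (TensorProduct.assoc ℂ (VacModule 𝔤 S) (CanFiber z) PolyDiff).toLinearMap ∘ₗ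
    (current B hB u z S v).rTensor PolyDiff

/-- The vector `j^{v₁}(z₁) ⋯ j^{v_n}(z_n) 1`, for the list `(z₁, v₁), …, (z_n, v_n)`; the currents
are composed through `𝒱^{z₁, …, z_n} → 𝒱^{z₁, …, z_{n-1}} → ⋯ → 𝒱` (when `S = ∅`). -/
def currentProduct (B : LinearMap.BilinForm ℂ 𝔤) (hB : B.lieInvariant 𝔤) (u : MeroFun) :
    List (ProjLine × 𝔤) → (S : Set ProjLine) → VacModule 𝔤 S ⊗[ℂ] PolyDiff
  | [], S => vacuum 𝔤 S ⊗ₜ 1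
  | p :: L, S => currentExt B hB u p.1 S p.2 (currentProduct B hB u L (insert p.1 S))

/-- The `n`-point function `<j^{v₁}(z₁) ⋯ j^{v_n}(z_n)>`. -/
def nPoint (B : LinearMap.BilinForm ℂ 𝔤) (hB : B.lieInvariant 𝔤) (u : MeroFun)
    (L : List (ProjLine × 𝔤)) : PolyDiff :=
  TensorProduct.lid ℂ PolyDiff ((vacProj ∅).rTensor PolyDiff (currentProduct B hB u L ∅))

end

end

end CurrentAlgebra

namespace CurrentAlgebra

noncomputable section

attribute [local instance 100] LieRing.ofAssociativeRing

/-! ### Values and differentials of regular functions -/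

/-! Two facts determine a current completely. On the vacuum it is `ε`, because `ι` vanishes there
(`current_vacuum`). Moving it past a map `α` costs only `-(v, dα(z)) + j^{[v, α(z)]}(z)`
(`currentExt_actExt`), a rule in which the coordinate no longer occurs explicitly. Since `𝒱^S` is
generated from the vacuum by the maps, an identity between currents need only be checked on the
vacuum and then carried through this rule (`vacExt_induction`).

Independence of the coordinate is of this kind. A coordinate is fractional linear, so with `t` the
uniformizer at `z` one has `1/(u - u(z)) = k/t + e` and `k du = dt` (`IsCoordinate.exists_inv_eq`).
The constant `e` kills the vacuum and `k` is absorbed by the differential, so `j^v(z) 1` depends on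
`t` alone.

Commutativity of currents at distinct points (`currentExt_comm`) is too. On the vacuum the two
orders differ by the commutator of two simple poles, and the partial fraction identity
`IsCoordinate.epsMap_lie` cancels it against the terms `ε^{[v, x]}/(u(z) - u(w))`.

For the recursion, the first current is commuted to the right until it meets the vacuum and becomes
a multiplication by a simple pole, which is then moved back to the left. Passing the `l`-th current
produces a contraction and a bracket term (`currentExt_currentProduct`). The pole finally stands on
the far left, where the projection to the vacuum kills it. The explicit formulas follow by iterating
the recursion. -/

lemma value_of_mem {z : ProjLine} {f : MeroFun} (h : f ∈ localRing z) :
    value z f = evalAt z ⟨f, h⟩ := dif_pos h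

lemma diff_of_mem {z : ProjLine} {f : MeroFun} (h : f ∈ localRing z) :
    diff z f = dAt z ⟨f, h⟩ := dif_pos h

lemma C_mem_localRing (z : ProjLine) (c : ℂ) : RatFunc.C c ∈ localRing z :=
  (localRing z).algebraMap_mem c

lemma value_C (z : ProjLine) (c : ℂ) : value z (RatFunc.C c) = c := by
  rw [value_of_mem (C_mem_localRing z c)]
  exact (evalAt z).commutes c

lemma value_add {z : ProjLine} {f g : MeroFun} (hf : f ∈ localRing z) (hg : g ∈ localRing z) :
    value z (f + g) = value z f + value z g := by
  rw [value_of_mem hf, value_of_mem hg, value_of_mem (add_mem hf hg), ← map_add]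
  rfl

lemma value_sub {z : ProjLine} {f g : MeroFun} (hf : f ∈ localRing z) (hg : g ∈ localRing z) :
    value z (f - g) = value z f - value z g := by
  rw [value_of_mem hf, value_of_mem hg, value_of_mem (sub_mem hf hg), ← map_sub]
  rfl

lemma value_mul {z : ProjLine} {f g : MeroFun} (hf : f ∈ localRing z) (hg : g ∈ localRing z) :
    value z (f * g) = value z f * value z g := by
  rw [value_of_mem hf, value_of_mem hg, value_of_mem (mul_mem hf hg), ← map_mul]
  rfl

lemma diff_C (z : ProjLine) (c : ℂ) : diff z (RatFunc.C c) = 0 := by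
  have h : (⟨RatFunc.C c, C_mem_localRing z c⟩ : localRing z) = c • 1 := by
    ext
    simp [Algebra.smul_def, RatFunc.algebraMap_eq_C]
  rw [diff_of_mem (C_mem_localRing z c), h, map_smul, dAt_one, smul_zero]

lemma diff_sub {z : ProjLine} {f g : MeroFun} (hf : f ∈ localRing z) (hg : g ∈ localRing z) :
    diff z (f - g) = diff z f - diff z g := by
  rw [diff_of_mem hf, diff_of_mem hg, diff_of_mem (sub_mem hf hg), ← map_sub]
  rfl

lemma diff_mul {z : ProjLine} {f g : MeroFun} (hf : f ∈ localRing z) (hg : g ∈ localRing z) :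
    diff z (f * g) = value z f • diff z g + value z g • diff z f := by
  rw [diff_of_mem hf, diff_of_mem hg, value_of_mem hf, value_of_mem hg,
    diff_of_mem (mul_mem hf hg), ← dAt_mul]
  rfl

/-! ### Regularity on the projective line -/

/-- The denominator of `f⁻¹` divides the numerator of `f`, so a pole of `f⁻¹` at `a` would force `f`
to vanish there. -/
lemma inv_mem_localRingFin {a : ℂ} {f : MeroFun} (hf : f ∈ localRingFin a)
    (h : evalFin a ⟨f, hf⟩ ≠ 0) : f⁻¹ ∈ localRingFin a := by
  have hf0 : f ≠ 0 := by
    rintro rfl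
    exact h (map_zero (evalFin a))
  intro h2
  have h3 := Polynomial.eval_eq_zero_of_dvd_of_eval_eq_zero (RatFunc.denom_inv_dvd hf0) h2
  apply h
  change RatFunc.eval (RingHom.id ℂ) a f = 0
  rw [RatFunc.eval, Polynomial.eval₂_id, h3, zero_div]

lemma algebraMap_mem_localRingFin (a : ℂ) (p : Polynomial ℂ) :
    algebraMap (Polynomial ℂ) (RatFunc ℂ) p ∈ localRingFin a := by
  change (RatFunc.denom _).eval a ≠ 0
  rw [RatFunc.denom_algebraMap]
  simp

lemma evalFin_algebraMap (a : ℂ) (p : Polynomial ℂ) :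
    evalFin a ⟨_, algebraMap_mem_localRingFin a p⟩ = p.eval a := by
  change RatFunc.eval (RingHom.id ℂ) a _ = _
  rw [RatFunc.eval_algebraMap]
  simp

lemma X_mem_localRingFin (a : ℂ) : (RatFunc.X : MeroFun) ∈ localRingFin a := by
  rw [← RatFunc.algebraMap_X]
  exact algebraMap_mem_localRingFin a _

lemma value_coe_X (a : ℂ) : value (a : ProjLine) RatFunc.X = a := by
  have h : (RatFunc.X : MeroFun) ∈ localRing (a : ProjLine) := X_mem_localRingFin a
  rw [value_of_mem h]
  exact RatFunc.eval_X _ _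

lemma invSubst_X : invSubst RatFunc.X = RatFunc.X⁻¹ := by
  rw [← RatFunc.algebraMap_X]
  unfold invSubst
  rw [RatFunc.liftAlgHom_apply, RatFunc.num_algebraMap, RatFunc.denom_algebraMap]
  simp

lemma invSubst_C (c : ℂ) : invSubst (RatFunc.C c) = RatFunc.C c :=
  invSubst.commutes c

lemma mem_localRing_infty {f : MeroFun} : f ∈ localRing ∞ ↔ invSubst f ∈ localRingFin 0 := Iff.rfl

lemma value_infty {f : MeroFun} (h : f ∈ localRing ∞) :
    value ∞ f = value ((0 : ℂ) : ProjLine) (invSubst f) := by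
  have h' : invSubst f ∈ localRing ((0 : ℂ) : ProjLine) := h
  rw [value_of_mem h, value_of_mem h']
  rfl

lemma inv_X_mem_localRing_infty : (RatFunc.X⁻¹ : MeroFun) ∈ localRing ∞ := by
  rw [mem_localRing_infty, map_inv₀, invSubst_X, inv_inv]
  exact X_mem_localRingFin 0

lemma value_infty_inv_X : value ∞ (RatFunc.X⁻¹ : MeroFun) = 0 := by
  rw [value_infty inv_X_mem_localRing_infty, map_inv₀, invSubst_X, inv_inv, value_coe_X]

/-- Under `X ↦ 1/X` the function `1/(X - a)` becomes `X/(1 - aX)`. This denominator has value `1` at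
`0`, which is what regularity at `∞` requires. -/
lemma one_sub_mul_X_inv_mem (a : ℂ) :
    (1 - RatFunc.C a * RatFunc.X : MeroFun)⁻¹ ∈ localRingFin 0 := by
  have e : (1 - RatFunc.C a * RatFunc.X : MeroFun) =
      algebraMap (Polynomial ℂ) (RatFunc ℂ) (1 - Polynomial.C a * Polynomial.X) := by
    simp [RatFunc.algebraMap_C, RatFunc.algebraMap_X]
  have h := algebraMap_mem_localRingFin 0 (1 - Polynomial.C a * Polynomial.X)
  rw [e]
  refine inv_mem_localRingFin h ?_
  rw [evalFin_algebraMap]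
  simp

/-- A uniformizer at a point of the projective line, with no other zero. -/
def locParam : ProjLine → MeroFun
  | ∞ => RatFunc.X⁻¹
  | (a : ℂ) => RatFunc.X - RatFunc.C a

lemma X_sub_C_ne_zero (a : ℂ) : (RatFunc.X - RatFunc.C a : MeroFun) ≠ 0 := by
  intro h
  -- At the point `a + 1` the difference takes the value `1`.
  have h2 := congrArg (value ((a + 1 : ℂ) : ProjLine)) h
  rw [value_sub (X_mem_localRingFin _) (C_mem_localRing _ _), value_coe_X, value_C,
    ← map_zero RatFunc.C, value_C] at h2
  simp at h2

lemma locParam_ne_zero (z : ProjLine) : locParam z ≠ 0 := by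
  induction z using OnePoint.rec with
  | infty => exact inv_ne_zero RatFunc.X_ne_zero
  | coe a => exact X_sub_C_ne_zero a

lemma locParam_mem (z : ProjLine) : locParam z ∈ localRing z := by
  induction z using OnePoint.rec with
  | infty => exact inv_X_mem_localRing_infty
  | coe a => exact sub_mem (X_mem_localRingFin a) (C_mem_localRing (a : ProjLine) a)

lemma value_locParam (z : ProjLine) : value z (locParam z) = 0 := by
  induction z using OnePoint.rec with
  | infty => exact value_infty_inv_X
  | coe a =>
    change value (a : ProjLine) (RatFunc.X - RatFunc.C a) = 0
    rw [value_sub (X_mem_localRingFin _) (C_mem_localRing _ _), value_coe_X, value_C, sub_self]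

lemma invSubst_X_sub_C_inv (a : ℂ) : invSubst (RatFunc.X - RatFunc.C a)⁻¹ =
    RatFunc.X * (1 - RatFunc.C a * RatFunc.X)⁻¹ := by
  have hX : (RatFunc.X : MeroFun) ≠ 0 := RatFunc.X_ne_zero
  rw [map_inv₀, map_sub, invSubst_X, invSubst_C]
  have : (RatFunc.X⁻¹ - RatFunc.C a : MeroFun) = RatFunc.X⁻¹ * (1 - RatFunc.C a * RatFunc.X) := by
    field_simp
  rw [this, mul_inv, inv_inv]

lemma locParam_inv_mem {z w : ProjLine} (h : w ≠ z) : (locParam z)⁻¹ ∈ localRing w := by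
  induction z using OnePoint.rec with
  | infty =>
    induction w using OnePoint.rec with
    | infty => exact absurd rfl h
    | coe b =>
      change (RatFunc.X⁻¹)⁻¹ ∈ localRingFin b
      rw [inv_inv]
      exact X_mem_localRingFin b
  | coe a =>
    induction w using OnePoint.rec with
    | infty =>
      change (RatFunc.X - RatFunc.C a)⁻¹ ∈ localRing ∞
      rw [mem_localRing_infty, invSubst_X_sub_C_inv]
      exact mul_mem (X_mem_localRingFin 0) (one_sub_mul_X_inv_mem a)
    | coe b =>
      have hm : (RatFunc.X - RatFunc.C a : MeroFun) ∈ localRing (b : ProjLine) :=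
        sub_mem (X_mem_localRingFin b) (C_mem_localRing (b : ProjLine) a)
      refine inv_mem_localRingFin hm ?_
      change evalAt (b : ProjLine) ⟨_, hm⟩ ≠ 0
      rw [← value_of_mem, value_sub (X_mem_localRingFin _) (C_mem_localRing _ _), value_coe_X,
        value_C, sub_ne_zero]
      exact fun e => h (congrArg _ e)

/-! ### Coordinates are fractional linear -/

/-- A nonconstant denominator would have a complex root, hence a finite pole. -/
lemma eq_algebraMap_of_regular {f : MeroFun} (h : ∀ a : ℂ, f ∈ localRingFin a) :
    f = algebraMap (Polynomial ℂ) (RatFunc ℂ) f.num := by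
  have hd : f.denom.degree = 0 := by
    by_contra hd
    obtain ⟨a, ha⟩ := IsAlgClosed.exists_root f.denom hd
    exact h a ha
  have h1 : f.denom = 1 :=
    Polynomial.eq_one_of_monic_natDegree_zero f.monic_denom
      (Polynomial.natDegree_eq_of_degree_eq_some hd)
  conv_lhs => rw [← f.num_div_denom, h1, map_one, div_one]

/-- This makes the pole order at `∞` visible: the constant term of the reversed polynomial is the
leading coefficient of `p`. -/
lemma invSubst_algebraMap (p : Polynomial ℂ) :
    RatFunc.X ^ p.natDegree * invSubst (algebraMap (Polynomial ℂ) (RatFunc ℂ) p) =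
      algebraMap (Polynomial ℂ) (RatFunc ℂ) p.reverse := by
  have hX : (RatFunc.X : MeroFun) ≠ 0 := RatFunc.X_ne_zero
  have h0 : invSubst (algebraMap (Polynomial ℂ) (RatFunc ℂ) p) =
      Polynomial.eval₂ (algebraMap ℂ (RatFunc ℂ)) (RatFunc.X⁻¹) p := by
    unfold invSubst
    rw [RatFunc.liftAlgHom_apply, RatFunc.num_algebraMap, RatFunc.denom_algebraMap, map_one,
      div_one]
    rfl
  have h1 : algebraMap (Polynomial ℂ) (RatFunc ℂ) p.reverse =
      Polynomial.eval₂ (algebraMap ℂ (RatFunc ℂ)) RatFunc.X p.reverse := by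
    rw [← RatFunc.algebraMap_X, ← Polynomial.aeval_def, Polynomial.aeval_algebraMap_apply]
    simp
  -- The reversal identity is applied at the point `X⁻¹`, whose inverse is `X`.
  let _ : Invertible (RatFunc.X⁻¹ : MeroFun) := invertibleOfNonzero (inv_ne_zero hX)
  have h2 := Polynomial.eval₂_reverse_mul_pow (algebraMap ℂ (RatFunc ℂ)) (RatFunc.X⁻¹ : MeroFun) p
  rw [invOf_eq_inv, inv_inv] at h2
  rw [h0, h1, ← h2, inv_pow]
  field_simp

/-- In degree `m + 2` the reversed polynomial would be `X ^ (m + 1)` times a function regular at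
`0`, so its constant term, the leading coefficient of `p`, would vanish. -/
lemma natDegree_le_one_of_regular {p : Polynomial ℂ}
    (h : RatFunc.X * invSubst (algebraMap (Polynomial ℂ) (RatFunc ℂ) p) ∈ localRingFin 0) :
    p.natDegree ≤ 1 := by
  by_contra! hd
  obtain ⟨m, hm⟩ : ∃ m, p.natDegree = m + 2 := ⟨p.natDegree - 2, by omega⟩
  have h1 := invSubst_algebraMap p
  rw [hm, pow_succ, mul_assoc] at h1
  have hX : (RatFunc.X : MeroFun) ∈ localRing ((0 : ℂ) : ProjLine) := X_mem_localRingFin 0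
  have h' : RatFunc.X * invSubst (algebraMap (Polynomial ℂ) (RatFunc ℂ) p) ∈
      localRing ((0 : ℂ) : ProjLine) := h
  have h2 := congrArg (value ((0 : ℂ) : ProjLine)) h1
  rw [pow_succ', mul_assoc, value_mul hX (mul_mem (pow_mem hX m) h'), value_coe_X, zero_mul,
    value_of_mem (show _ ∈ localRing ((0 : ℂ) : ProjLine) from
      algebraMap_mem_localRingFin 0 p.reverse)] at h2
  have h3 : p.reverse.eval 0 = 0 := by
    rw [← evalFin_algebraMap]
    exact h2.symm
  rw [← Polynomial.coeff_zero_eq_eval_zero, Polynomial.coeff_zero_reverse,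
    Polynomial.leadingCoeff_eq_zero] at h3
  simp [h3] at hm

lemma algebraMap_of_natDegree_le_one {p : Polynomial ℂ} (hp : p.natDegree ≤ 1) :
    ∃ a b : ℂ, algebraMap (Polynomial ℂ) (RatFunc ℂ) p = RatFunc.C a * RatFunc.X + RatFunc.C b := by
  obtain ⟨a, b, rfl⟩ := Polynomial.exists_eq_X_add_C_of_natDegree_le_one hp
  exact ⟨a, b, by simp [RatFunc.algebraMap_C, RatFunc.algebraMap_X]⟩

/-- A coordinate is a fractional linear function of the affine coordinate. -/
lemma IsCoordinate.exists_eq {u : MeroFun} (hu : IsCoordinate u) : ∃ a b c d : ℂ,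
    a * d - b * c ≠ 0 ∧ u * (RatFunc.C c * RatFunc.X + RatFunc.C d) =
      RatFunc.C a * RatFunc.X + RatFunc.C b := by
  obtain ⟨P, hP, hs, hr⟩ := hu
  have hX : (RatFunc.X : MeroFun) ≠ 0 := RatFunc.X_ne_zero
  induction P using OnePoint.rec with
  | infty =>
    have h1 := eq_algebraMap_of_regular (f := u) fun a => hr a (OnePoint.coe_ne_infty a)
    -- Simplicity of the pole is used on `1/X`, a uniformizer at `∞`; it bounds the degree of the
    -- polynomial `u` by one.
    have h2 := hs _ inv_X_mem_localRing_infty value_infty_inv_X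
    rw [mem_localRing_infty, map_mul, map_inv₀, invSubst_X, inv_inv, h1] at h2
    obtain ⟨a, b, hab⟩ := algebraMap_of_natDegree_le_one (natDegree_le_one_of_regular h2)
    rw [← h1] at hab
    refine ⟨a, b, 0, 1, ?_, ?_⟩
    · intro ha
      obtain rfl : a = 0 := by simpa using ha
      apply hP
      rw [hab, map_zero, zero_mul, zero_add]
      exact C_mem_localRing _ _
    · simp [hab]
  | coe p =>
    have hm : (RatFunc.X - RatFunc.C p : MeroFun) ∈ localRing (p : ProjLine) :=
      locParam_mem (p : ProjLine)
    have h0 := hs _ hm (value_locParam (p : ProjLine))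
    -- The factor `X - p` cancels the only pole of `u`, and regularity of `u` at `∞` leaves `(X - p)
    -- u` with at most a simple pole there. Hence it is a polynomial of degree at most one.
    have h1 := eq_algebraMap_of_regular (f := (RatFunc.X - RatFunc.C p) * u) fun a => by
      by_cases hap : a = p
      · rw [hap]; exact h0
      · exact mul_mem (sub_mem (X_mem_localRingFin a) (C_mem_localRing (a : ProjLine) p))
          (hr a fun e => hap (OnePoint.coe_injective e))
    have h2 : invSubst u ∈ localRingFin 0 := hr ∞ (OnePoint.infty_ne_coe p)
    obtain ⟨a, b, hab⟩ := algebraMap_of_natDegree_le_one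
      (p := ((RatFunc.X - RatFunc.C p) * u).num) (natDegree_le_one_of_regular (by
        rw [← h1, map_mul, map_sub, invSubst_X, invSubst_C, ← mul_assoc, mul_sub,
          mul_inv_cancel₀ hX]
        exact mul_mem (sub_mem (one_mem _) (mul_mem (X_mem_localRingFin 0)
          (C_mem_localRing ((0 : ℂ) : ProjLine) p))) h2))
    rw [← h1] at hab
    refine ⟨a, b, 1, -p, ?_, ?_⟩
    · intro ha
      -- A vanishing determinant makes `u` equal to the constant `a`, contradicting the pole at `p`.
      obtain rfl : b = -(a * p) := by linear_combination -ha
      apply hP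
      have : u = RatFunc.C a := by
        apply mul_left_cancel₀ (X_sub_C_ne_zero p)
        rw [hab]
        simp
        ring
      rw [this]
      exact C_mem_localRing _ _
    · rw [← hab]
      simp
      ring

/-- The value of `u` at `∞` is `a / c`, and `u - a/c = D / (c (c x + d))`. -/
lemma inv_mul_linear_eq {F : Type*} [Field F] {u x a b c d D : F} (hc : c ≠ 0) (hx : x ≠ 0)
    (hD : D ≠ 0) (hDe : D = b * c - a * d) (h : u * (c * x + d) = a * x + b) :
    (u - a / c) * (c ^ 2 / D + c * d / D * x⁻¹) = x⁻¹ := by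
  field_simp
  linear_combination c * h - hDe

/-- Here `u - u(p) = D (x - p) / (q (c x + d))`, and `c x + d = q + c (x - p)`. -/
lemma sub_mul_linear_eq {F : Type*} [Field F] {u x p a b c d q D : F} (hq : q ≠ 0)
    (hqe : q = c * p + d) (hD : D ≠ 0) (hDe : D = a * d - b * c)
    (h : u * (c * x + d) = a * x + b) :
    (u - (a * p + b) / q) * (q ^ 2 / D + c * q / D * (x - p)) = x - p := by
  field_simp
  rw [hDe, hqe]
  linear_combination (c * p + d) * h

/-- A coordinate is, up to an affine change, the inverse of the simple pole at any point where it
is regular. -/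
lemma IsCoordinate.exists_inv_sub_value {u : MeroFun} (hu : IsCoordinate u) {z : ProjLine}
    (hz : u ∈ localRing z) : ∃ k e : ℂ, (u - RatFunc.C (value z u)) *
      (RatFunc.C k + RatFunc.C e * locParam z) = locParam z := by
  obtain ⟨a, b, c, d, hD, h⟩ := hu.exists_eq
  have hX : (RatFunc.X : MeroFun) ≠ 0 := RatFunc.X_ne_zero
  have hC : ∀ x : ℂ, x ≠ 0 → (RatFunc.C x : MeroFun) ≠ 0 := fun x hx => by simpa using hx
  induction z using OnePoint.rec with
  | infty =>
    have hmem : ∀ x y : ℂ, (RatFunc.C x + RatFunc.C y * RatFunc.X⁻¹ : MeroFun) ∈ localRing ∞ :=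
      fun x y => add_mem (C_mem_localRing _ _)
        (mul_mem (C_mem_localRing _ _) inv_X_mem_localRing_infty)
    have hval : ∀ x y : ℂ, value ∞ (RatFunc.C x + RatFunc.C y * RatFunc.X⁻¹ : MeroFun) = x :=
      fun x y => by
        rw [value_add (C_mem_localRing _ _)
          (mul_mem (C_mem_localRing _ _) inv_X_mem_localRing_infty),
          value_mul (C_mem_localRing _ _) inv_X_mem_localRing_infty, value_infty_inv_X, value_C,
          mul_zero, add_zero]
    have h2 : u * (RatFunc.C c + RatFunc.C d * RatFunc.X⁻¹) =
        RatFunc.C a + RatFunc.C b * RatFunc.X⁻¹ := by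
      field_simp
      linear_combination h
    have h3 := congrArg (value ∞) h2
    rw [value_mul hz (hmem c d), hval, hval] at h3
    -- Regularity at `∞` excludes `c = 0`: evaluating `h2` there would give `a = 0` and a zero
    -- determinant.
    have hc : c ≠ 0 := by
      rintro rfl
      apply hD
      rw [← h3]
      ring
    have hu0 : value ∞ u = a / c := by rw [← h3]; field_simp
    refine ⟨c ^ 2 / (b * c - a * d), c * d / (b * c - a * d), ?_⟩
    have hD' : b * c - a * d ≠ 0 := fun e => hD (by linear_combination -e)
    have := inv_mul_linear_eq (hC c hc) hX (hC _ hD') (by simp) h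
    change _ * (_ + _ * RatFunc.X⁻¹) = RatFunc.X⁻¹
    rw [hu0]
    simpa only [map_div₀, map_mul, map_pow] using this
  | coe p =>
    have hXm : (RatFunc.X : MeroFun) ∈ localRing (p : ProjLine) := X_mem_localRingFin p
    have hmem : ∀ x y : ℂ, (RatFunc.C x * RatFunc.X + RatFunc.C y : MeroFun) ∈
        localRing (p : ProjLine) :=
      fun x y => add_mem (mul_mem (C_mem_localRing _ _) hXm) (C_mem_localRing _ _)
    have hval : ∀ x y : ℂ, value (p : ProjLine) (RatFunc.C x * RatFunc.X + RatFunc.C y : MeroFun) =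
        x * p + y :=
      fun x y => by
        rw [value_add (mul_mem (C_mem_localRing _ _) hXm) (C_mem_localRing _ _),
          value_mul (C_mem_localRing _ _) hXm, value_coe_X, value_C, value_C]
    have h3 := congrArg (value (p : ProjLine)) h
    rw [value_mul hz (hmem c d), hval, hval] at h3
    -- If denominator and numerator both vanished at `p`, the determinant would be zero.
    have hc : c * p + d ≠ 0 := by
      intro e
      rw [e, mul_zero] at h3
      apply hD
      linear_combination a * e + c * h3
    have hu0 : value (p : ProjLine) u = (a * p + b) / (c * p + d) := by rw [← h3]; field_simp
    refine ⟨(c * p + d) ^ 2 / (a * d - b * c), c * (c * p + d) / (a * d - b * c), ?_⟩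
    have := sub_mul_linear_eq (p := RatFunc.C p) (hC _ hc) (by simp) (hC _ hD) (by simp) h
    change _ * (_ + _ * (RatFunc.X - RatFunc.C p)) = RatFunc.X - RatFunc.C p
    rw [hu0]
    simpa only [map_div₀, map_mul, map_pow, map_add] using this

lemma IsCoordinate.sub_C_ne_zero {u : MeroFun} (hu : IsCoordinate u) (c : ℂ) :
    u - RatFunc.C c ≠ 0 := by
  obtain ⟨P, hP, -⟩ := hu
  intro h
  rw [sub_eq_zero] at h
  exact hP (h ▸ C_mem_localRing P c)

/-- The simple pole at `z` defined by a coordinate, and the differential of the coordinate, in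
terms of the uniformizer at `z`. -/
lemma IsCoordinate.exists_inv_eq {u : MeroFun} (hu : IsCoordinate u) {z : ProjLine}
    (hz : u ∈ localRing z) : ∃ k e : ℂ, (u - RatFunc.C (value z u))⁻¹ =
      RatFunc.C k * (locParam z)⁻¹ + RatFunc.C e ∧ k • diff z u = diff z (locParam z) := by
  obtain ⟨k, e, h⟩ := hu.exists_inv_sub_value hz
  refine ⟨k, e, ?_, ?_⟩
  · have h1 := hu.sub_C_ne_zero (value z u)
    have h2 := locParam_ne_zero z
    field_simp
    linear_combination -h
  · have hC := C_mem_localRing z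
    have hl := locParam_mem z
    -- In the Leibniz rule the factor `u - u(z)` vanishes at `z` and the other factor has value `k`,
    -- which leaves `k du = dt`.
    have h2 := congrArg (diff z) h
    rw [diff_mul (sub_mem hz (hC _)) (add_mem (hC k) (mul_mem (hC e) hl)),
      value_sub hz (hC _), value_add (hC k) (mul_mem (hC e) hl), value_mul (hC e) hl,
      value_locParam, diff_sub hz (hC _), diff_C, value_C, value_C] at h2
    simpa using h2

/-- The function `1 / (u - u(z))` is regular away from `z`. -/
lemma IsCoordinate.inv_mem {u : MeroFun} (hu : IsCoordinate u) {z w : ProjLine}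
    (hz : u ∈ localRing z) (hw : w ≠ z) : (u - RatFunc.C (value z u))⁻¹ ∈ localRing w := by
  obtain ⟨k, e, h, -⟩ := hu.exists_inv_eq hz
  rw [h]
  exact add_mem (mul_mem (C_mem_localRing _ _) (locParam_inv_mem hw)) (C_mem_localRing _ _)

lemma IsCoordinate.value_inv_mul {u : MeroFun} (hu : IsCoordinate u) {z w : ProjLine}
    (hz : u ∈ localRing z) (hw : u ∈ localRing w) (hne : w ≠ z) :
    (value w u - value z u) * value w (u - RatFunc.C (value z u))⁻¹ = 1 := by
  have hC := C_mem_localRing w (value z u)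
  rw [← value_C w (value z u), ← value_sub hw hC, value_C,
    ← value_mul (sub_mem hw hC) (hu.inv_mem hz hne), mul_inv_cancel₀ (hu.sub_C_ne_zero _),
    ← map_one RatFunc.C, value_C]

/-- A coordinate separates points because `1/(u - u(z))` is regular at `w`: the two values multiply
to `1`. -/
lemma IsCoordinate.value_sub_ne_zero {u : MeroFun} (hu : IsCoordinate u) {z w : ProjLine}
    (hz : u ∈ localRing z) (hw : u ∈ localRing w) (hne : w ≠ z) :
    value w u - value z u ≠ 0 :=
  left_ne_zero_of_mul_eq_one (hu.value_inv_mul hz hw hne)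

lemma IsCoordinate.value_inv {u : MeroFun} (hu : IsCoordinate u) {z w : ProjLine}
    (hz : u ∈ localRing z) (hw : u ∈ localRing w) (hne : w ≠ z) :
    value w (u - RatFunc.C (value z u))⁻¹ = 1 / (value w u - value z u) :=
  eq_one_div_of_mul_eq_one_right (hu.value_inv_mul hz hw hne)

/-- Obtained by differentiating `(u - u(z)) (u - u(z))⁻¹ = 1` at `w`. -/
lemma IsCoordinate.diff_inv {u : MeroFun} (hu : IsCoordinate u) {z w : ProjLine}
    (hz : u ∈ localRing z) (hw : u ∈ localRing w) (hne : w ≠ z) :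
    diff w (u - RatFunc.C (value z u))⁻¹ =
    -(1 / (value w u - value z u) ^ 2) • diff w u := by
  have hC := C_mem_localRing w (value z u)
  have h0 := hu.value_sub_ne_zero hz hw hne
  have h := diff_mul (sub_mem hw hC) (hu.inv_mem hz hne)
  rw [mul_inv_cancel₀ (hu.sub_C_ne_zero _), ← map_one RatFunc.C, diff_C, value_sub hw hC, value_C,
    hu.value_inv hz hw hne, diff_sub hw hC, diff_C, sub_zero] at h
  rw [← smul_right_inj h0, eq_neg_of_add_eq_zero_left h.symm, smul_smul, ← neg_smul]
  congr 1
  field_simp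

variable {𝔤 : Type*} [LieRing 𝔤] [LieAlgebra ℂ 𝔤]

/-! ### Maps regular on a set, and their restriction -/

lemma mem_regularOn {S : Set ProjLine} {f : MeroFun} :
    f ∈ regularOn S ↔ ∀ z ∈ S, f ∈ localRing z := by
  simp [regularOn, Algebra.mem_iInf]

lemma toRegular_of_mem {S : Set ProjLine} {f : MeroFun} (h : f ∈ regularOn S) :
    toRegular S f = ⟨f, h⟩ := dif_pos h

lemma mapOf_add_left {S : Set ProjLine} (f g : regularOn S) (x : 𝔤) :
    mapOf (f + g) x = mapOf f x + mapOf g x := TensorProduct.add_tmul f g x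

lemma mapOf_sub_left {S : Set ProjLine} (f g : regularOn S) (x : 𝔤) :
    mapOf (f - g) x = mapOf f x - mapOf g x := TensorProduct.sub_tmul f g x

lemma mapOf_smul_left {S : Set ProjLine} (c : ℂ) (f : regularOn S) (x : 𝔤) :
    mapOf (c • f) x = c • mapOf f x := (TensorProduct.smul_tmul' c f x).symm

lemma mapValue_mk {S : Set ProjLine} {z : ProjLine} (hz : z ∈ S) {f : MeroFun}
    (hf : f ∈ regularOn S) (v : 𝔤) :
    mapValue hz (mapOf ⟨f, hf⟩ v) = value z f • v := by
  rw [value_of_mem (regularOn_le hz hf)]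
  rfl

lemma pairDiff_mk (B : LinearMap.BilinForm ℂ 𝔤) {S : Set ProjLine} {z : ProjLine} (hz : z ∈ S)
    {f : MeroFun} (hf : f ∈ regularOn S) (v w : 𝔤) :
    pairDiff B hz v (mapOf ⟨f, hf⟩ w) = B v w • diff z f := by
  rw [diff_of_mem (regularOn_le hz hf)]
  rfl

lemma inclMaps_mapOf {S T : Set ProjLine} (h : S ⊆ T) (f : regularOn T) (x : 𝔤) :
    inclMaps h (mapOf f x) = mapOf (Subalgebra.inclusion (regularOn_anti h) f) x := rfl

lemma mapValue_inclMaps {S T : Set ProjLine} (h : S ⊆ T) {z : ProjLine} (hz : z ∈ S)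
    (hz' : z ∈ T) (α : MeroMaps 𝔤 T) : mapValue hz (inclMaps h α) = mapValue hz' α := by
  induction α using meroMaps_induction with
  | zero => simp
  | add α β h₁ h₂ => simp only [map_add, h₁, h₂]
  | tmul f x => rw [inclMaps_mapOf, mapValue_mapOf, mapValue_mapOf, Subalgebra.inclusion_inclusion]

lemma pairDiff_inclMaps (B : LinearMap.BilinForm ℂ 𝔤) {S T : Set ProjLine} (h : S ⊆ T)
    {z : ProjLine} (hz : z ∈ S) (hz' : z ∈ T) (v : 𝔤) (α : MeroMaps 𝔤 T) :
    pairDiff B hz v (inclMaps h α) = pairDiff B hz' v α := by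
  induction α using meroMaps_induction with
  | zero => simp
  | add α β h₁ h₂ => simp only [map_add, h₁, h₂]
  | tmul f x => rw [inclMaps_mapOf, pairDiff_mapOf, pairDiff_mapOf, Subalgebra.inclusion_inclusion]

lemma inclMaps_inclMaps {S T R : Set ProjLine} (h : S ⊆ T) (h' : T ⊆ R) (α : MeroMaps 𝔤 R) :
    inclMaps h (inclMaps h' α) = inclMaps (h.trans h') α := by
  induction α using meroMaps_induction with
  | zero => simp
  | add α β h₁ h₂ => simp only [map_add, h₁, h₂]
  | tmul f x => rw [inclMaps_mapOf, inclMaps_mapOf, inclMaps_mapOf, Subalgebra.inclusion_inclusion]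

lemma IsCoordinate.inv_mem_regularOn {u : MeroFun} (hu : IsCoordinate u) {z : ProjLine}
    (hz : u ∈ localRing z) {S : Set ProjLine} (hS : z ∉ S) :
    (u - RatFunc.C (value z u))⁻¹ ∈ regularOn S :=
  mem_regularOn.mpr fun _ hw => hu.inv_mem hz fun e => hS (e ▸ hw)

lemma IsCoordinate.epsMap_eq {u : MeroFun} (hu : IsCoordinate u) {z : ProjLine}
    (hz : u ∈ localRing z) {S : Set ProjLine} (hS : z ∉ S) (v : 𝔤) :
    epsMap 𝔤 u z S v = mapOf ⟨_, hu.inv_mem_regularOn hz hS⟩ v := by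
  rw [epsMap, toRegular_of_mem]

lemma IsCoordinate.inclMaps_epsMap {u : MeroFun} (hu : IsCoordinate u) {z : ProjLine}
    (hz : u ∈ localRing z) {S T : Set ProjLine} (h : S ⊆ T) (hT : z ∉ T) (v : 𝔤) :
    inclMaps h (epsMap 𝔤 u z T v) = epsMap 𝔤 u z S v := by
  rw [hu.epsMap_eq hz hT, hu.epsMap_eq hz fun hS => hT (h hS)]
  rfl

/-! ### Polydifferential coefficients -/

/-- Left multiplication by a map, extended to polydifferential coefficients. -/
def actExt (S : Set ProjLine) (α : MeroMaps 𝔤 S) :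
    VacModule 𝔤 S ⊗[ℂ] PolyDiff →ₗ[ℂ] VacModule 𝔤 S ⊗[ℂ] PolyDiff :=
  (act S α).rTensor PolyDiff

/-- The natural map `𝒱^T → 𝒱^S`, extended to polydifferential coefficients. -/
def inclExt {S T : Set ProjLine} (h : S ⊆ T) :
    VacModule 𝔤 T ⊗[ℂ] PolyDiff →ₗ[ℂ] VacModule 𝔤 S ⊗[ℂ] PolyDiff :=
  (inclVac h).rTensor PolyDiff

variable (𝔤) in
/-- Multiplication of the coefficients by a polydifferential. -/
def mulExt (S : Set ProjLine) :
    PolyDiff →ₗ[ℂ] VacModule 𝔤 S ⊗[ℂ] PolyDiff →ₗ[ℂ] VacModule 𝔤 S ⊗[ℂ] PolyDiff :=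
  LinearMap.lTensorHom (VacModule 𝔤 S) ∘ₗ LinearMap.mul ℂ PolyDiff

lemma actExt_tmul {S : Set ProjLine} (α : MeroMaps 𝔤 S) (x : VacModule 𝔤 S) (p : PolyDiff) :
    actExt S α (x ⊗ₜ p) = act S α x ⊗ₜ p := by
  rw [actExt, LinearMap.rTensor_tmul]

lemma inclExt_tmul {S T : Set ProjLine} (h : S ⊆ T) (x : VacModule 𝔤 T) (p : PolyDiff) :
    inclExt h (x ⊗ₜ p) = inclVac h x ⊗ₜ p := by
  rw [inclExt, LinearMap.rTensor_tmul]

lemma mulExt_tmul {S : Set ProjLine} (q : PolyDiff) (x : VacModule 𝔤 S) (p : PolyDiff) :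
    mulExt 𝔤 S q (x ⊗ₜ p) = x ⊗ₜ (q * p) := by
  rw [mulExt, LinearMap.comp_apply, LinearMap.coe_lTensorHom, LinearMap.lTensor_tmul,
    LinearMap.mul_apply']

lemma actExt_add {S : Set ProjLine} (α β : MeroMaps 𝔤 S) (X : VacModule 𝔤 S ⊗[ℂ] PolyDiff) :
    actExt S (α + β) X = actExt S α X + actExt S β X := by
  simp only [actExt, map_add, LinearMap.rTensor_add, LinearMap.add_apply]

lemma actExt_smul {S : Set ProjLine} (c : ℂ) (α : MeroMaps 𝔤 S)
    (X : VacModule 𝔤 S ⊗[ℂ] PolyDiff) : actExt S (c • α) X = c • actExt S α X := by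
  simp only [actExt, map_smul, LinearMap.rTensor_smul, LinearMap.smul_apply]

lemma actExt_sub {S : Set ProjLine} (α β : MeroMaps 𝔤 S) (X : VacModule 𝔤 S ⊗[ℂ] PolyDiff) :
    actExt S (α - β) X = actExt S α X - actExt S β X := by
  simp only [actExt, map_sub, LinearMap.rTensor_sub, LinearMap.sub_apply]

lemma actExt_lie {S : Set ProjLine} (α β : MeroMaps 𝔤 S) (X : VacModule 𝔤 S ⊗[ℂ] PolyDiff) :
    actExt S ⁅α, β⁆ X = actExt S α (actExt S β X) - actExt S β (actExt S α X) := by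
  simp only [actExt, LieHom.map_lie, LieRing.of_associative_ring_bracket, LinearMap.rTensor_sub,
    LinearMap.rTensor_mul]
  rfl

lemma inclExt_mulExt {S T : Set ProjLine} (h : S ⊆ T) (q : PolyDiff)
    (X : VacModule 𝔤 T ⊗[ℂ] PolyDiff) :
    inclExt h (mulExt 𝔤 T q X) = mulExt 𝔤 S q (inclExt h X) := by
  induction X using TensorProduct.induction_on with
  | zero => simp only [map_zero]
  | add X Y h₁ h₂ => simp only [map_add, h₁, h₂]
  | tmul x p => simp only [inclExt_tmul, mulExt_tmul]

lemma mulExt_mul {S : Set ProjLine} (q r : PolyDiff) (X : VacModule 𝔤 S ⊗[ℂ] PolyDiff) :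
    mulExt 𝔤 S (q * r) X = mulExt 𝔤 S q (mulExt 𝔤 S r X) := by
  induction X using TensorProduct.induction_on with
  | zero => simp only [map_zero]
  | add X Y h₁ h₂ => simp only [map_add, h₁, h₂]
  | tmul x p => simp only [mulExt_tmul, mul_assoc]

lemma mulExt_comm {S : Set ProjLine} (q r : PolyDiff) (X : VacModule 𝔤 S ⊗[ℂ] PolyDiff) :
    mulExt 𝔤 S q (mulExt 𝔤 S r X) = mulExt 𝔤 S r (mulExt 𝔤 S q X) := by
  rw [← mulExt_mul, mul_comm, mulExt_mul]

lemma inclExt_actExt {S T : Set ProjLine} (h : S ⊆ T) (α : MeroMaps 𝔤 T)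
    (X : VacModule 𝔤 T ⊗[ℂ] PolyDiff) :
    inclExt h (actExt T α X) = actExt S (inclMaps h α) (inclExt h X) := by
  induction X using TensorProduct.induction_on with
  | zero => simp only [map_zero]
  | add X Y h₁ h₂ => simp only [map_add, h₁, h₂]
  | tmul x p => simp only [actExt_tmul, inclExt_tmul, inclVac_act]

/-- There is no case for scalars: a scalar is moved into the polydifferential, which is arbitrary in
the vacuum case. -/
lemma vacExt_induction {S : Set ProjLine} {P : VacModule 𝔤 S ⊗[ℂ] PolyDiff → Prop}
    (X : VacModule 𝔤 S ⊗[ℂ] PolyDiff) (vac : ∀ p, P (vacuum 𝔤 S ⊗ₜ p))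
    (add : ∀ X Y, P X → P Y → P (X + Y)) (act : ∀ α X, P X → P (actExt S α X)) : P X := by
  induction X using TensorProduct.induction_on with
  | zero => simpa using vac 0
  | add X Y h₁ h₂ => exact add X Y h₁ h₂
  | tmul x p =>
    induction x using vac_induction generalizing p with
    | vac => exact vac p
    | smul c x h => rw [TensorProduct.smul_tmul]; exact h _
    | add x y h₁ h₂ => rw [TensorProduct.add_tmul]; exact add _ _ (h₁ p) (h₂ p)
    | act α x h => exact act α _ (h p)

lemma inclExt_inclExt {S T R : Set ProjLine} (h : S ⊆ T) (h' : T ⊆ R)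
    (X : VacModule 𝔤 R ⊗[ℂ] PolyDiff) :
    inclExt h (inclExt h' X) = inclExt (h.trans h') X := by
  induction X using vacExt_induction with
  | vac p => simp only [inclExt_tmul, inclVac_vacuum]
  | add X Y h₁ h₂ => simp only [map_add, h₁, h₂]
  | act α X ih => simp only [inclExt_actExt, inclMaps_inclMaps, ih]

/-! ### The rules of calculation with currents -/

section

variable (B : LinearMap.BilinForm ℂ 𝔤) (hB : B.lieInvariant 𝔤) (u : MeroFun)

lemma currentExt_tmul (z : ProjLine) (S : Set ProjLine) (v : 𝔤) (x : VacModule 𝔤 (insert z S))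
    (p : PolyDiff) : currentExt B hB u z S v (x ⊗ₜ p) =
      (LinearMap.mulRight ℂ p ∘ₗ ofFiber z).lTensor (VacModule 𝔤 S) (current B hB u z S v x) := by
  simp only [currentExt, LinearMap.comp_apply, LinearMap.rTensor_tmul, LinearEquiv.coe_coe]
  generalize current B hB u z S v x = y
  induction y using TensorProduct.induction_on with
  | zero => simp
  | add x y h₁ h₂ => simp only [TensorProduct.add_tmul, map_add, h₁, h₂]
  | tmul y k => simp

lemma current_vacuum (z : ProjLine) (S : Set ProjLine) (v : 𝔤) :
    current B hB u z S v (vacuum 𝔤 _) = eps 𝔤 u z S v (vacuum 𝔤 S) := by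
  rw [current, LinearMap.add_apply, iota_vacuum, add_zero, LinearMap.comp_apply, inclVac_vacuum]

lemma currentExt_vacuum (z : ProjLine) (S : Set ProjLine) (v : 𝔤) (p : PolyDiff) :
    currentExt B hB u z S v (vacuum 𝔤 _ ⊗ₜ p) =
      actExt S (epsMap 𝔤 u z S v) (vacuum 𝔤 S ⊗ₜ (du u z * p)) := by
  rw [currentExt_tmul, current_vacuum, eps_apply, LinearMap.lTensor_tmul]
  rfl

/-- The recursion for `ι` is designed for this: its term `-[ε, α]` cancels the commutator of `ε`
with `α`, and its last term completes `ι^{[v, α(z)]}` to a current. -/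
lemma current_act (z : ProjLine) (S : Set ProjLine) (v : 𝔤) (α : MeroMaps 𝔤 (insert z S))
    (x : VacModule 𝔤 (insert z S)) :
    current B hB u z S v (act _ α x) =
      (act S (inclMaps (Set.subset_insert z S) α)).rTensor (CanFiber z) (current B hB u z S v x)
      - inclVac (Set.subset_insert z S) x ⊗ₜ pairDiff B (Set.mem_insert z S) v α
      + current B hB u z S ⁅v, mapValue (Set.mem_insert z S) α⁆ x := by
  simp only [current, LinearMap.add_apply, LinearMap.comp_apply, inclVac_act, map_add]
  rw [iota_act]
  abel

/-- The commutation rule `j^v(z) α - α j^v(z) = -(v, dα(z)) + j^{[v, α(z)]}(z)`. -/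
lemma currentExt_actExt (z : ProjLine) (S : Set ProjLine) (v : 𝔤) (α : MeroMaps 𝔤 (insert z S))
    (X : VacModule 𝔤 (insert z S) ⊗[ℂ] PolyDiff) :
    currentExt B hB u z S v (actExt _ α X) =
      actExt S (inclMaps (Set.subset_insert z S) α) (currentExt B hB u z S v X)
      - mulExt 𝔤 S (ofFiber z (pairDiff B (Set.mem_insert z S) v α))
          (inclExt (Set.subset_insert z S) X)
      + currentExt B hB u z S ⁅v, mapValue (Set.mem_insert z S) α⁆ X := by
  induction X using TensorProduct.induction_on with
  | zero => simp only [map_zero, sub_zero, add_zero]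
  | add X Y h₁ h₂ => simp only [map_add, h₁, h₂]; abel
  | tmul x p =>
    rw [actExt_tmul, currentExt_tmul, current_act, map_add, map_sub, ← currentExt_tmul]
    congr 2
    rw [currentExt_tmul, actExt]
    generalize current B hB u z S v x = y
    rw [← LinearMap.comp_apply, ← LinearMap.comp_apply, LinearMap.lTensor_comp_rTensor,
      LinearMap.rTensor_comp_lTensor]

lemma currentExt_smul (z : ProjLine) (S : Set ProjLine) (c : ℂ) (v : 𝔤)
    (X : VacModule 𝔤 (insert z S) ⊗[ℂ] PolyDiff) :
    currentExt B hB u z S (c • v) X = c • currentExt B hB u z S v X := by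
  induction X using TensorProduct.induction_on with
  | zero => simp only [map_zero, smul_zero]
  | add X Y h₁ h₂ => simp only [map_add, h₁, h₂, smul_add]
  | tmul x p =>
    have h : current B hB u z S (c • v) x = c • current B hB u z S v x := by
      simp only [current, LinearMap.add_apply, LinearMap.comp_apply, map_smul, smul_add, iota,
        LinearMap.smul_apply, LinearMap.applyₗ_apply_apply, LinearMap.fst_apply]
    rw [currentExt_tmul, currentExt_tmul, h, map_smul]

lemma currentExt_mulExt (z : ProjLine) (S : Set ProjLine) (v : 𝔤) (q : PolyDiff)
    (X : VacModule 𝔤 (insert z S) ⊗[ℂ] PolyDiff) :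
    currentExt B hB u z S v (mulExt 𝔤 _ q X) = mulExt 𝔤 S q (currentExt B hB u z S v X) := by
  induction X using TensorProduct.induction_on with
  | zero => simp only [map_zero]
  | add X Y h₁ h₂ => simp only [map_add, h₁, h₂]
  | tmul x p =>
    rw [mulExt_tmul, currentExt_tmul, currentExt_tmul]
    generalize current B hB u z S v x = y
    induction y using TensorProduct.induction_on with
    | zero => simp only [map_zero]
    | add x y h₁ h₂ => simp only [map_add, h₁, h₂]
    | tmul y k =>
      simp only [LinearMap.lTensor_tmul, mulExt_tmul, LinearMap.comp_apply,
        LinearMap.mulRight_apply]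
      rw [mul_left_comm]

end

/-! ### Restriction, change of coordinate and commutativity of currents -/

section

variable (B : LinearMap.BilinForm ℂ 𝔤) (hB : B.lieInvariant 𝔤) {u : MeroFun}

/-- The currents are compatible with the maps `𝒱^T → 𝒱^S`. -/
lemma currentExt_inclExt (hu : IsCoordinate u) {z : ProjLine} (hz : u ∈ localRing z)
    {S T : Set ProjLine} (h : S ⊆ T)
    (hT : z ∉ T) (v : 𝔤) (X : VacModule 𝔤 (insert z T) ⊗[ℂ] PolyDiff) :
    currentExt B hB u z S v (inclExt (Set.insert_subset_insert h) X) =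
      inclExt h (currentExt B hB u z T v X) := by
  -- The vector `v` must vary, since passing a map replaces it by `[v, α(z)]`.
  induction X using vacExt_induction generalizing v with
  | vac p =>
    rw [currentExt_vacuum, inclExt_actExt, inclExt_tmul, inclExt_tmul, inclVac_vacuum,
      inclVac_vacuum, currentExt_vacuum, hu.inclMaps_epsMap hz h hT]
  | add X Y h₁ h₂ => simp only [map_add, h₁, h₂]
  | act α X ih =>
    simp only [inclExt_actExt, currentExt_actExt, ih, map_add, map_sub, inclExt_mulExt,
      inclMaps_inclMaps, inclExt_inclExt]
    rw [pairDiff_inclMaps, mapValue_inclMaps]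

/-- The vector `j^v(z) 1` in terms of the uniformizer at `z`. -/
lemma IsCoordinate.epsMap_vacuum (hu : IsCoordinate u) {z : ProjLine} (hz : u ∈ localRing z)
    {S : Set ProjLine} (hS : z ∉ S) (v : 𝔤) (p : PolyDiff) :
    actExt S (epsMap 𝔤 u z S v) (vacuum 𝔤 S ⊗ₜ (du u z * p)) =
      actExt S (mapOf (toRegular S (locParam z)⁻¹) v)
        (vacuum 𝔤 S ⊗ₜ (ofFiber z (diff z (locParam z)) * p)) := by
  obtain ⟨k, e, h, hd⟩ := hu.exists_inv_eq hz
  have hm : (locParam z)⁻¹ ∈ regularOn S :=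
    mem_regularOn.mpr fun w hw => locParam_inv_mem fun e => hS (e ▸ hw)
  -- The constant summand kills the vacuum; the factor `k` of the polar part turns `du` into the
  -- differential of the uniformizer.
  have h1 : epsMap 𝔤 u z S v = k • mapOf (toRegular S (locParam z)⁻¹) v + e • mapOf 1 v := by
    rw [hu.epsMap_eq hz hS, toRegular_of_mem hm]
    rw [← mapOf_smul_left, ← mapOf_smul_left, ← mapOf_add_left]
    congr 2
    ext
    simp [h, Algebra.smul_def, RatFunc.algebraMap_eq_C]
  rw [h1, actExt_add, actExt_smul, actExt_smul, ← hd, actExt_tmul, actExt_tmul, actExt_tmul,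
    act_const, TensorProduct.zero_tmul, smul_zero, add_zero, map_smul, smul_mul_assoc,
    TensorProduct.tmul_smul, du]

/-- The currents do not depend on the coordinate. -/
lemma currentExt_eq (hu : IsCoordinate u) {w : MeroFun} (hw : IsCoordinate w) {z : ProjLine}
    (hz : u ∈ localRing z)
    (hz' : w ∈ localRing z) {S : Set ProjLine} (hS : z ∉ S) (v : 𝔤)
    (X : VacModule 𝔤 (insert z S) ⊗[ℂ] PolyDiff) :
    currentExt B hB u z S v X = currentExt B hB w z S v X := by
  induction X using vacExt_induction generalizing v with
  | vac p =>
    rw [currentExt_vacuum, currentExt_vacuum, hu.epsMap_vacuum hz hS, hw.epsMap_vacuum hz' hS]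
  | add X Y h₁ h₂ => simp only [map_add, h₁, h₂]
  | act α X ih => simp only [currentExt_actExt, ih]

lemma currentProduct_eq (hu : IsCoordinate u) {w : MeroFun} (hw : IsCoordinate w)
    (L : List (ProjLine × 𝔤))
    (hL : (L.map Prod.fst).Nodup) (hLu : ∀ p ∈ L, u ∈ localRing p.1)
    (hLw : ∀ p ∈ L, w ∈ localRing p.1) (S : Set ProjLine) (hS : ∀ p ∈ L, p.1 ∉ S) :
    currentProduct B hB u L S = currentProduct B hB w L S := by
  induction L generalizing S with
  | nil => rfl
  | cons p L ih =>
    simp only [List.map_cons, List.nodup_cons, List.forall_mem_cons] at hL hLu hLw hS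
    rw [currentProduct, currentProduct, currentExt_eq B hB hu hw hLu.1 hLw.1 hS.1,
      ih hL.2 hLu.2 hLw.2]
    rintro q hq (h | h)
    · exact hL.1 (h ▸ List.mem_map_of_mem hq)
    · exact hS.2 q hq h

/-- The commutator of a current with the simple pole defining `ε`. -/
lemma currentExt_actExt_epsMap (hu : IsCoordinate u) {z w : ProjLine} (hz : u ∈ localRing z)
    (hw : u ∈ localRing w)
    (hne : z ≠ w) {S : Set ProjLine} (hS : w ∉ S) (v x : 𝔤)
    (X : VacModule 𝔤 (insert z S) ⊗[ℂ] PolyDiff) :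
    currentExt B hB u z S v (actExt _ (epsMap 𝔤 u w (insert z S) x) X) =
      actExt S (epsMap 𝔤 u w S x) (currentExt B hB u z S v X)
      + (B v x / (value z u - value w u) ^ 2) • mulExt 𝔤 S (du u z)
          (inclExt (Set.subset_insert z S) X)
      + (1 / (value z u - value w u)) • currentExt B hB u z S ⁅v, x⁆ X := by
  have hS' : w ∉ insert z S := by
    rintro (h | h)
    · exact hne h.symm
    · exact hS h
  -- The minus sign from differentiating `1/(u - u(w))` cancels the one in `-(v, dα(z))`, so the
  -- double pole enters with a plus sign.
  rw [currentExt_actExt, hu.inclMaps_epsMap hw _ hS', hu.epsMap_eq hw hS', pairDiff_mk,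
    mapValue_mk, hu.diff_inv hw hz hne, hu.value_inv hw hz hne, lie_smul, currentExt_smul,
    smul_smul, map_smul, map_smul, LinearMap.smul_apply, mul_neg, neg_smul, sub_neg_eq_add,
    mul_one_div]
  rfl

/-- The vacuum case of commutativity. The two multiplications by poles appear in the order opposite
to that of the currents, so comparing both orders of currents needs their commutator. -/
lemma currentExt_currentExt_vacuum (hu : IsCoordinate u) {z w : ProjLine} (hz : u ∈ localRing z)
    (hw : u ∈ localRing w)
    (hne : z ≠ w) {S : Set ProjLine} (hS : w ∉ S) (v x : 𝔤) (p : PolyDiff) :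
    currentExt B hB u z S v (currentExt B hB u w (insert z S) x (vacuum 𝔤 _ ⊗ₜ p)) =
      actExt S (epsMap 𝔤 u w S x) (actExt S (epsMap 𝔤 u z S v)
        (vacuum 𝔤 S ⊗ₜ (du u z * du u w * p)))
      + (B v x / (value z u - value w u) ^ 2) • vacuum 𝔤 S ⊗ₜ (du u z * du u w * p)
      + (1 / (value z u - value w u)) •
          actExt S (epsMap 𝔤 u z S ⁅v, x⁆) (vacuum 𝔤 S ⊗ₜ (du u z * du u w * p)) := by
  rw [currentExt_vacuum, currentExt_actExt_epsMap B hB hu hz hw hne hS, currentExt_vacuum,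
    currentExt_vacuum, inclExt_tmul, inclVac_vacuum, mulExt_tmul, mul_assoc]

/-- Partial fractions for `1 / ((u - u(z)) (u - u(w)))`. -/
lemma IsCoordinate.epsMap_lie (hu : IsCoordinate u) {z w : ProjLine} (hz : u ∈ localRing z)
    (hw : u ∈ localRing w) (hne : z ≠ w) {S : Set ProjLine} (hzS : z ∉ S) (hwS : w ∉ S) (v x : 𝔤) :
    ⁅epsMap 𝔤 u z S v, epsMap 𝔤 u w S x⁆ =
      (1 / (value z u - value w u)) • (epsMap 𝔤 u z S ⁅v, x⁆ - epsMap 𝔤 u w S ⁅v, x⁆) := by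
  have h0 : (RatFunc.C (value z u - value w u) : MeroFun) ≠ 0 :=
    (map_ne_zero RatFunc.C).mpr (hu.value_sub_ne_zero hw hz hne)
  have h1 := hu.sub_C_ne_zero (value z u)
  have h2 := hu.sub_C_ne_zero (value w u)
  simp only [hu.epsMap_eq hz hzS, hu.epsMap_eq hw hwS, mapOf_lie]
  rw [← mapOf_sub_left, ← mapOf_smul_left]
  congr 2
  ext
  rw [SetLike.val_smul]
  simp only [MulMemClass.coe_mul, AddSubgroupClass.coe_sub, Algebra.smul_def,
    RatFunc.algebraMap_eq_C]
  rw [map_div₀, map_one]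
  field_simp
  simp only [map_sub]
  ring

/-- Currents at distinct points commute. -/
lemma currentExt_comm (hu : IsCoordinate u) (hsymm : B.IsSymm) {z w : ProjLine}
    (hz : u ∈ localRing z)
    (hw : u ∈ localRing w) (hne : z ≠ w) {S : Set ProjLine} (hzS : z ∉ S) (hwS : w ∉ S) (v x : 𝔤)
    (X : VacModule 𝔤 (insert w (insert z S)) ⊗[ℂ] PolyDiff) :
    currentExt B hB u z S v (currentExt B hB u w (insert z S) x X) =
      currentExt B hB u w S x (currentExt B hB u z (insert w S) v
        (inclExt (Set.insert_comm w z S).ge X)) := by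
  have hz' : z ∉ insert w S := by
    rintro (h | h)
    · exact hne h
    · exact hzS h
  have hw' : w ∉ insert z S := by
    rintro (h | h)
    · exact hne h.symm
    · exact hwS h
  induction X using vacExt_induction generalizing v x with
  | vac p =>
    rw [inclExt_tmul, inclVac_vacuum, currentExt_currentExt_vacuum B hB hu hz hw hne hwS,
      currentExt_currentExt_vacuum B hB hu hw hz hne.symm hzS, mul_comm (du u w),
      hsymm.eq x v]
    generalize vacuum 𝔤 S ⊗ₜ[ℂ] (du u z * du u w * p) = V
    have h := congrArg (fun α => actExt S α V) (hu.epsMap_lie hz hw hne hzS hwS v x)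
    simp only [actExt_lie, actExt_smul, actExt_sub] at h
    have e1 : epsMap 𝔤 u w S ⁅x, v⁆ = (-1 : ℂ) • epsMap 𝔤 u w S ⁅v, x⁆ := by
      rw [← lie_skew, epsMap, epsMap, map_neg, neg_one_smul]
    have e2 : (value w u - value z u) ^ 2 = (value z u - value w u) ^ 2 := by ring
    have e3 : 1 / (value w u - value z u) = -(1 / (value z u - value w u)) := by
      rw [← neg_sub (value z u), div_neg]
    rw [e1, e2, e3, actExt_smul]
    linear_combination (norm := module) -h
  | add X Y h₁ h₂ => simp only [map_add, h₁, h₂]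
  | act α X ih =>
    -- Moving `α` past both currents leaves single currents of restricted vectors with coefficients
    -- `(v, dα(z))` or `(x, dα(w))`. Compatibility with restriction matches these; the bracket terms
    -- are the induction hypothesis for changed `v` or `x`.
    have e1 := currentExt_inclExt B hB hu hw (Set.subset_insert z S) hw' x X
    have e2 := currentExt_inclExt B hB hu hz (Set.subset_insert w S) hz' v
      (inclExt (Set.insert_comm w z S).ge X)
    rw [inclExt_inclExt] at e2
    simp only [inclExt_actExt, currentExt_actExt, ih, map_add, map_sub, currentExt_mulExt,
      inclExt_inclExt, ← e1, ← e2, inclMaps_inclMaps]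
    rw [pairDiff_inclMaps B _ _ (Set.mem_insert_of_mem _ (Set.mem_insert z S)),
      pairDiff_inclMaps B _ _ (Set.mem_insert_of_mem _ (Set.mem_insert z S)),
      pairDiff_inclMaps B _ _ (Set.mem_insert w _),
      mapValue_inclMaps _ _ (Set.mem_insert_of_mem _ (Set.mem_insert z S)),
      mapValue_inclMaps _ _ (Set.mem_insert_of_mem _ (Set.mem_insert z S)),
      mapValue_inclMaps _ _ (Set.mem_insert w _)]
    abel

end

/-! ### The recursion for the correlation functions -/

section

variable (B : LinearMap.BilinForm ℂ 𝔤) (hB : B.lieInvariant 𝔤) {u : MeroFun}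

/-- Reordering or dropping a current changes the set on which the remaining product must be regular;
this identifies the resulting vectors. -/
lemma inclExt_currentProduct (hu : IsCoordinate u) {S T : Set ProjLine} (h : S ⊆ T)
    (L : List (ProjLine × 𝔤)) (hL : (L.map Prod.fst).Nodup) (hLu : ∀ p ∈ L, u ∈ localRing p.1)
    (hT : ∀ p ∈ L, p.1 ∉ T) :
    inclExt h (currentProduct B hB u L T) = currentProduct B hB u L S := by
  induction L generalizing S T with
  | nil => rw [currentProduct, currentProduct, inclExt_tmul, inclVac_vacuum]
  | cons p L ih =>
    simp only [List.map_cons, List.nodup_cons, List.forall_mem_cons] at hL hLu hT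
    rw [currentProduct, currentProduct, ← currentExt_inclExt B hB hu hLu.1 h hT.1,
      ih (Set.insert_subset_insert h) hL.2 hLu.2]
    rintro q hq (h | h)
    · exact hL.1 (h ▸ List.mem_map_of_mem hq)
    · exact hT.2 q hq h

/-- The first current of a product, moved to the right. -/
lemma currentExt_currentProduct (hu : IsCoordinate u) (hsymm : B.IsSymm) {z : ProjLine}
    (hz : u ∈ localRing z) (v : 𝔤) (L : List (ProjLine × 𝔤))
    (hL : (L.map Prod.fst).Nodup) (hLu : ∀ p ∈ L, u ∈ localRing p.1) (hzL : ∀ p ∈ L, z ≠ p.1)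
    (S : Set ProjLine) (hzS : z ∉ S) (hS : ∀ p ∈ L, p.1 ∉ S) :
    currentExt B hB u z S v (currentProduct B hB u L (insert z S)) =
      actExt S (epsMap 𝔤 u z S v) (mulExt 𝔤 S (du u z) (currentProduct B hB u L S)) +
      ∑ l : Fin L.length,
        ((B v (L.get l).2 / (value z u - value (L.get l).1 u) ^ 2) •
            mulExt 𝔤 S (du u z * du u (L.get l).1) (currentProduct B hB u (L.eraseIdx l) S) +
          (1 / (value z u - value (L.get l).1 u)) •
            mulExt 𝔤 S (du u z)
              (currentProduct B hB u (L.set l ((L.get l).1, ⁅v, (L.get l).2⁆)) S)) := by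
  induction L generalizing S with
  | nil =>
    simp only [currentProduct, currentExt_vacuum, mulExt_tmul]
    simp
  | cons p L ih =>
    simp only [List.map_cons, List.nodup_cons, List.forall_mem_cons] at hL hLu hzL hS
    have hne : ∀ q ∈ L, q.1 ≠ p.1 := fun q hq h => hL.1 (h ▸ List.mem_map_of_mem hq)
    have hpS : ∀ q ∈ L, q.1 ∉ insert p.1 S := by
      rintro q hq (h | h)
      · exact hne q hq h
      · exact hS.2 q hq h
    have hzpS : z ∉ insert p.1 S := by
      rintro (h | h)
      · exact hzL.1 h
      · exact hzS h
    -- The two sets are equal but not definitionally so; restriction along the equality serves as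
    -- transport.
    have hcomm : inclExt (Set.insert_comm p.1 z S).ge
        (currentProduct B hB u L (insert p.1 (insert z S))) =
          currentProduct B hB u L (insert z (insert p.1 S)) := by
      refine inclExt_currentProduct B hB hu _ L hL.2 hLu.2 fun q hq => ?_
      rw [Set.insert_comm]
      rintro (h | h)
      · exact hzL.2 q hq h.symm
      · exact hpS q hq h
    have hsub : inclExt (Set.subset_insert p.1 S) (currentProduct B hB u L (insert p.1 S)) =
        currentProduct B hB u L S :=
      inclExt_currentProduct B hB hu _ L hL.2 hLu.2 hpS
    have e1 : ⁅p.2, v⁆ = (-1 : ℂ) • ⁅v, p.2⁆ := by rw [neg_one_smul, lie_skew]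
    have e2 : (value p.1 u - value z u) ^ 2 = (value z u - value p.1 u) ^ 2 := by ring
    have e3 : 1 / (value p.1 u - value z u) = -(1 / (value z u - value p.1 u)) := by
      rw [← neg_sub (value z u), div_neg]
    -- The current at `z` is swapped with the head, the induction hypothesis is used over the set
    -- enlarged by the head's point, and the head is then moved past the pole at `z`. That last
    -- commutator is the summand `l = 0`; the head applied to the inductive sum gives the others.
    rw [currentProduct, currentExt_comm B hB hu hsymm hz hLu.1 hzL.1 hzS hS.1, hcomm,
      ih hL.2 hLu.2 hzL.2 _ hzpS hpS, map_add,
      currentExt_actExt_epsMap B hB hu hLu.1 hz hzL.1.symm hzS, map_sum, e1, currentExt_smul,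
      e2, e3, hsymm.eq p.2 v]
    simp only [List.length_cons, Fin.sum_univ_succ, List.get_eq_getElem, Fin.val_zero, Fin.val_succ,
      List.getElem_cons_zero, List.getElem_cons_succ, List.eraseIdx_cons_zero,
      List.eraseIdx_cons_succ, List.set_cons_zero, List.set_cons_succ, currentProduct,
      currentExt_mulExt, inclExt_mulExt, hsub, mulExt_mul, map_add, map_smul]
    rw [mulExt_comm (du u p.1)]
    module

/-- The projection is induced from the zero representation, so it kills every `α · x`, in particular
the leading pole term of `currentExt_currentProduct`. -/
lemma lid_vacProj_actExt (α : MeroMaps 𝔤 ∅) (X : VacModule 𝔤 ∅ ⊗[ℂ] PolyDiff) :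
    TensorProduct.lid ℂ PolyDiff ((vacProj ∅).rTensor PolyDiff (actExt ∅ α X)) = 0 := by
  induction X using TensorProduct.induction_on with
  | zero => simp only [map_zero]
  | add X Y h₁ h₂ => simp only [map_add, h₁, h₂, add_zero]
  | tmul x p =>
    have h : vacProj ∅ (act ∅ α x) = 0 := induced_act 0 1 (fun _ => rfl) α x
    rw [actExt_tmul, LinearMap.rTensor_tmul, h, TensorProduct.zero_tmul, map_zero]

lemma lid_vacProj_mulExt (q : PolyDiff) (X : VacModule 𝔤 ∅ ⊗[ℂ] PolyDiff) :
    TensorProduct.lid ℂ PolyDiff ((vacProj ∅).rTensor PolyDiff (mulExt 𝔤 ∅ q X)) =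
      q * TensorProduct.lid ℂ PolyDiff ((vacProj ∅).rTensor PolyDiff X) := by
  induction X using TensorProduct.induction_on with
  | zero => simp only [map_zero, mul_zero]
  | add X Y h₁ h₂ => simp only [map_add, h₁, h₂, mul_add]
  | tmul x p =>
    rw [mulExt_tmul, LinearMap.rTensor_tmul, LinearMap.rTensor_tmul, TensorProduct.lid_tmul,
      TensorProduct.lid_tmul, mul_smul_comm]

lemma nPoint_nil : nPoint B hB u [] = 1 := by
  rw [nPoint, currentProduct, LinearMap.rTensor_tmul, TensorProduct.lid_tmul, vacProj,
    induced_vacuum, one_smul]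

lemma nPoint_cons (hu : IsCoordinate u) (hsymm : B.IsSymm) (z : ProjLine) (v : 𝔤)
    (L : List (ProjLine × 𝔤)) (hL : (((z, v) :: L).map Prod.fst).Nodup)
    (hLu : ∀ p ∈ (z, v) :: L, u ∈ localRing p.1) :
    nPoint B hB u ((z, v) :: L) =
      ∑ l : Fin L.length,
        ((B v (L.get l).2 / (value z u - value (L.get l).1 u) ^ 2) •
            (du u z * du u (L.get l).1 * nPoint B hB u (L.eraseIdx l)) +
          (1 / (value z u - value (L.get l).1 u)) •
            (du u z * nPoint B hB u (L.set l ((L.get l).1, ⁅v, (L.get l).2⁆)))) := by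
  simp only [List.map_cons, List.nodup_cons, List.forall_mem_cons] at hL hLu
  rw [nPoint, currentProduct, currentExt_currentProduct B hB hu hsymm hLu.1 v L hL.2 hLu.2
    (fun p hp h => hL.1 (h ▸ List.mem_map_of_mem hp)) ∅ (Set.notMem_empty _)
    fun _ _ => Set.notMem_empty _]
  simp only [map_add, map_sum, map_smul, lid_vacProj_actExt, lid_vacProj_mulExt, zero_add]
  rfl

/-! ### Explicit correlation functions of low order -/

lemma nPoint_singleton (hu : IsCoordinate u) (hsymm : B.IsSymm) {z : ProjLine}
    (hz : u ∈ localRing z) (v : 𝔤) : nPoint B hB u [(z, v)] = 0 := by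
  rw [nPoint_cons B hB hu hsymm z v [] (by simp) (by simpa using hz)]
  rfl

lemma nPoint_pair (hu : IsCoordinate u) (hsymm : B.IsSymm) {z₁ z₂ : ProjLine}
    (h₁ : u ∈ localRing z₁) (h₂ : u ∈ localRing z₂) (h₁₂ : z₁ ≠ z₂) (v₁ v₂ : 𝔤) :
    nPoint B hB u [(z₁, v₁), (z₂, v₂)] =
      (B v₁ v₂ / (value z₁ u - value z₂ u) ^ 2) • (du u z₁ * du u z₂) := by
  rw [nPoint_cons B hB hu hsymm _ _ _ (by simpa using h₁₂) (by simp [h₁, h₂])]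
  simp [nPoint_nil, nPoint_singleton B hB hu hsymm h₂]

lemma nPoint_triple (hu : IsCoordinate u) (hsymm : B.IsSymm) {z₁ z₂ z₃ : ProjLine}
    (h₁ : u ∈ localRing z₁) (h₂ : u ∈ localRing z₂) (h₃ : u ∈ localRing z₃) (h₁₂ : z₁ ≠ z₂)
    (h₁₃ : z₁ ≠ z₃) (h₂₃ : z₂ ≠ z₃) (v₁ v₂ v₃ : 𝔤) :
    nPoint B hB u [(z₁, v₁), (z₂, v₂), (z₃, v₃)] =
      (B v₁ ⁅v₂, v₃⁆ / ((value z₁ u - value z₂ u) * (value z₁ u - value z₃ u) *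
        (value z₂ u - value z₃ u))) • (du u z₁ * du u z₂ * du u z₃) := by
  -- Contractions leave a one-point function, which is zero. Invariance makes both bracket terms
  -- multiples of `(v₁, [v₂, v₃])`.
  have e1 : B ⁅v₁, v₂⁆ v₃ = B v₁ ⁅v₂, v₃⁆ := by
    rw [← lie_skew, map_neg, LinearMap.neg_apply, hB, neg_neg]
  have e2 : B v₂ ⁅v₁, v₃⁆ = -B v₁ ⁅v₂, v₃⁆ := by rw [← e1, hB, neg_neg]
  rw [nPoint_cons B hB hu hsymm _ _ _ (by simp [h₁₂, h₁₃, h₂₃]) (by simp [h₁, h₂, h₃])]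
  simp only [List.length_cons, List.length_nil, Fin.sum_univ_succ, List.get_eq_getElem,
    Fin.val_zero, Fin.val_succ, List.getElem_cons_zero, List.getElem_cons_succ,
    List.eraseIdx_cons_zero,
    List.eraseIdx_cons_succ, List.set_cons_zero, List.set_cons_succ, Finset.univ_eq_empty,
    Finset.sum_empty, nPoint_singleton B hB hu hsymm h₂, nPoint_singleton B hB hu hsymm h₃,
    nPoint_pair B hB hu hsymm h₂ h₃ h₂₃, mul_zero, smul_zero, zero_add, add_zero, e1, e2,
    mul_smul_comm, smul_smul, ← mul_assoc, ← add_smul]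
  have h12 := hu.value_sub_ne_zero h₂ h₁ h₁₂
  have h13 := hu.value_sub_ne_zero h₃ h₁ h₁₃
  have h23 := hu.value_sub_ne_zero h₃ h₂ h₂₃
  -- What remains is `1/(u₁₂ u₂₃²) - 1/(u₁₃ u₂₃²) = 1/(u₁₂ u₁₃ u₂₃)`, from `u₁₃ - u₁₂ = u₂₃`.
  congr 1
  field_simp
  ring

lemma nPoint_quadruple (hu : IsCoordinate u) (hsymm : B.IsSymm) {z₁ z₂ z₃ z₄ : ProjLine}
    (h₁ : u ∈ localRing z₁) (h₂ : u ∈ localRing z₂) (h₃ : u ∈ localRing z₃)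
    (h₄ : u ∈ localRing z₄) (h₁₂ : z₁ ≠ z₂) (h₁₃ : z₁ ≠ z₃) (h₁₄ : z₁ ≠ z₄) (h₂₃ : z₂ ≠ z₃)
    (h₂₄ : z₂ ≠ z₄) (h₃₄ : z₃ ≠ z₄) (v₁ v₂ v₃ v₄ : 𝔤) :
    nPoint B hB u [(z₁, v₁), (z₂, v₂), (z₃, v₃), (z₄, v₄)] =
      (B v₁ v₂ * B v₃ v₄ / ((value z₁ u - value z₂ u) ^ 2 * (value z₃ u - value z₄ u) ^ 2)
        + B v₁ v₃ * B v₂ v₄ / ((value z₁ u - value z₃ u) ^ 2 * (value z₂ u - value z₄ u) ^ 2)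
        + B v₁ v₄ * B v₂ v₃ / ((value z₁ u - value z₄ u) ^ 2 * (value z₂ u - value z₃ u) ^ 2)
        + B ⁅v₁, v₂⁆ ⁅v₃, v₄⁆ / ((value z₁ u - value z₂ u) * (value z₂ u - value z₃ u) *
          (value z₂ u - value z₄ u) * (value z₃ u - value z₄ u))
        - B ⁅v₁, v₃⁆ ⁅v₂, v₄⁆ / ((value z₁ u - value z₃ u) * (value z₂ u - value z₃ u) *
          (value z₂ u - value z₄ u) * (value z₃ u - value z₄ u))
        + B ⁅v₁, v₄⁆ ⁅v₂, v₃⁆ / ((value z₁ u - value z₄ u) * (value z₃ u - value z₄ u) *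
          (value z₂ u - value z₄ u) * (value z₂ u - value z₃ u))) •
        (du u z₁ * du u z₂ * du u z₃ * du u z₄) := by
  -- Three-point functions with one entry replaced by a bracket have to be paired as bracket against
  -- bracket. The term with `[v₁, v₂]` already has this form; the other two are converted by
  -- invariance.
  have e1 : B v₂ ⁅⁅v₁, v₃⁆, v₄⁆ = -B ⁅v₁, v₃⁆ ⁅v₂, v₄⁆ := by
    rw [← hB v₂, ← lie_skew v₂ ⁅v₁, v₃⁆, map_neg, LinearMap.neg_apply, hB, neg_neg]
  have e2 : B v₂ ⁅v₃, ⁅v₁, v₄⁆⁆ = B ⁅v₁, v₄⁆ ⁅v₂, v₃⁆ := by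
    rw [hsymm.eq ⁅v₁, v₄⁆, ← lie_skew v₂ v₃, map_neg, LinearMap.neg_apply, hB, neg_neg]
  rw [nPoint_cons B hB hu hsymm _ _ _ (by simp [h₁₂, h₁₃, h₁₄, h₂₃, h₂₄, h₃₄])
    (by simp [h₁, h₂, h₃, h₄])]
  simp only [List.length_cons, List.length_nil, Fin.sum_univ_succ, List.get_eq_getElem,
    Fin.val_zero, Fin.val_succ, List.getElem_cons_zero, List.getElem_cons_succ,
    List.eraseIdx_cons_zero,
    List.eraseIdx_cons_succ, List.set_cons_zero, List.set_cons_succ, Finset.univ_eq_empty,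
    Finset.sum_empty, nPoint_pair B hB hu hsymm h₂ h₃ h₂₃, nPoint_pair B hB hu hsymm h₂ h₄ h₂₄,
    nPoint_pair B hB hu hsymm h₃ h₄ h₃₄, nPoint_triple B hB hu hsymm h₂ h₃ h₄ h₂₃ h₂₄ h₃₄,
    add_zero, e1, e2, mul_smul_comm, smul_smul, ← mul_assoc]
  -- The contractions with the third and fourth currents produce the differentials out of order.
  rw [mul_right_comm (du u z₁) (du u z₃), mul_right_comm (du u z₁) (du u z₄),
    mul_right_comm (du u z₁ * du u z₂) (du u z₄)]
  simp only [← add_smul]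
  have h12 := hu.value_sub_ne_zero h₂ h₁ h₁₂
  have h13 := hu.value_sub_ne_zero h₃ h₁ h₁₃
  have h14 := hu.value_sub_ne_zero h₄ h₁ h₁₄
  have h23 := hu.value_sub_ne_zero h₃ h₂ h₂₃
  have h24 := hu.value_sub_ne_zero h₄ h₂ h₂₄
  have h34 := hu.value_sub_ne_zero h₄ h₃ h₃₄
  congr 1
  field_simp
  ring

end

end

end CurrentAlgebra


theorem mainTheorem9 {𝔤 : Type*} [LieRing 𝔤] [LieAlgebra ℂ 𝔤] (B : LinearMap.BilinForm ℂ 𝔤)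
    (hsymm : B.IsSymm) (hnd : B.Nondegenerate) (hinv : B.lieInvariant 𝔤)
    (u : CurrentAlgebra.MeroFun) (hu : CurrentAlgebra.IsCoordinate u) :
    -- the correlation functions do not depend on the coordinate that is used to define `ε` and `ι`
    (∀ (w : CurrentAlgebra.MeroFun), CurrentAlgebra.IsCoordinate w →
      ∀ L : List (CurrentAlgebra.ProjLine × 𝔤), (L.map Prod.fst).Nodup →
      (∀ p ∈ L, u ∈ CurrentAlgebra.localRing p.1) → (∀ p ∈ L, w ∈ CurrentAlgebra.localRing p.1) →
      CurrentAlgebra.nPoint B hinv u L = CurrentAlgebra.nPoint B hinv w L) ∧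
    -- the recursion
    (∀ (z₁ : CurrentAlgebra.ProjLine) (v₁ : 𝔤) (L : List (CurrentAlgebra.ProjLine × 𝔤)),
      (((z₁, v₁) :: L).map Prod.fst).Nodup →
      (∀ p ∈ (z₁, v₁) :: L, u ∈ CurrentAlgebra.localRing p.1) →
      CurrentAlgebra.nPoint B hinv u ((z₁, v₁) :: L) =
        ∑ l : Fin L.length,
          ((B v₁ L[l].2 / (CurrentAlgebra.value z₁ u - CurrentAlgebra.value L[l].1 u) ^ 2) •
              (CurrentAlgebra.du u z₁ * CurrentAlgebra.du u L[l].1 *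
                CurrentAlgebra.nPoint B hinv u (L.eraseIdx l)) +
            (1 / (CurrentAlgebra.value z₁ u - CurrentAlgebra.value L[l].1 u)) •
              (CurrentAlgebra.du u z₁ *
                CurrentAlgebra.nPoint B hinv u (L.set l (L[l].1, ⁅v₁, L[l].2⁆))))) ∧
    -- the two-point function
    (∀ (z : Fin 2 → CurrentAlgebra.ProjLine) (v : Fin 2 → 𝔤), Function.Injective z →
      (∀ i, u ∈ CurrentAlgebra.localRing (z i)) →
      CurrentAlgebra.nPoint B hinv u (List.ofFn fun i => (z i, v i)) =
        (B (v 0) (v 1) / (CurrentAlgebra.value (z 0) u - CurrentAlgebra.value (z 1) u) ^ 2) •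
          ∏ i, CurrentAlgebra.du u (z i)) ∧
    -- the three-point function
    (∀ (z : Fin 3 → CurrentAlgebra.ProjLine) (v : Fin 3 → 𝔤), Function.Injective z →
      (∀ i, u ∈ CurrentAlgebra.localRing (z i)) →
      let d : Fin 3 → Fin 3 → ℂ :=
        fun i j => CurrentAlgebra.value (z i) u - CurrentAlgebra.value (z j) u
      CurrentAlgebra.nPoint B hinv u (List.ofFn fun i => (z i, v i)) =
        (B (v 0) ⁅v 1, v 2⁆ / (d 0 1 * d 0 2 * d 1 2)) • ∏ i, CurrentAlgebra.du u (z i)) ∧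
    -- the four-point function
    (∀ (z : Fin 4 → CurrentAlgebra.ProjLine) (v : Fin 4 → 𝔤), Function.Injective z →
      (∀ i, u ∈ CurrentAlgebra.localRing (z i)) →
      let d : Fin 4 → Fin 4 → ℂ :=
        fun i j => CurrentAlgebra.value (z i) u - CurrentAlgebra.value (z j) u
      CurrentAlgebra.nPoint B hinv u (List.ofFn fun i => (z i, v i)) =
        (B (v 0) (v 1) * B (v 2) (v 3) / (d 0 1 ^ 2 * d 2 3 ^ 2)
          + B (v 0) (v 2) * B (v 1) (v 3) / (d 0 2 ^ 2 * d 1 3 ^ 2)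
          + B (v 0) (v 3) * B (v 1) (v 2) / (d 0 3 ^ 2 * d 1 2 ^ 2)
          + B ⁅v 0, v 1⁆ ⁅v 2, v 3⁆ / (d 0 1 * d 1 2 * d 1 3 * d 2 3)
          - B ⁅v 0, v 2⁆ ⁅v 1, v 3⁆ / (d 0 2 * d 1 2 * d 1 3 * d 2 3)
          + B ⁅v 0, v 3⁆ ⁅v 1, v 2⁆ / (d 0 3 * d 2 3 * d 1 3 * d 1 2)) •
          ∏ i, CurrentAlgebra.du u (z i)) := by
  open CurrentAlgebra in
  refine ⟨fun w hw L hL hLu hLw => ?_, fun z₁ v₁ L => nPoint_cons B hinv hu hsymm z₁ v₁ L,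
    fun z v hz h => ?_, fun z v hz h => ?_, fun z v hz h => ?_⟩
  · rw [nPoint, nPoint, currentProduct_eq B hinv hu hw L hL hLu hLw ∅
      fun _ _ => Set.notMem_empty _]
  · rw [Fin.prod_univ_two]
    exact nPoint_pair B hinv hu hsymm (h 0) (h 1) (hz.ne (by decide)) (v 0) (v 1)
  · rw [Fin.prod_univ_three]
    exact nPoint_triple B hinv hu hsymm (h 0) (h 1) (h 2) (hz.ne (by decide))
      (hz.ne (by decide)) (hz.ne (by decide)) (v 0) (v 1) (v 2)
  · rw [Fin.prod_univ_four]
    exact nPoint_quadruple B hinv hu hsymm (h 0) (h 1) (h 2) (h 3) (hz.ne (by decide))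
      (hz.ne (by decide)) (hz.ne (by decide)) (hz.ne (by decide)) (hz.ne (by decide))
      (hz.ne (by decide)) (v 0) (v 1) (v 2) (v 3)
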